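/- Let $1\le k\le B$ be integers, $\mu>0$, and let $\lambda:[0,\infty)\to[0,\infty)$ be continuous. Consider the queue $M(t)|M[k,B]|1$: customers arrive one at a time according to a (non-stationary) Poisson process of intensity $\lambda(t)$; there is one server; whenever the server is free and at least $k$ customers are in the queue, a service starts, which takes all the customers in the queue, but at most $B$ of them; customers arriving during a service join the queue; the service times are independent, exponentially distributed with parameter $\mu$, and independent of the arrivals; at time $0$ the system is empty. For $0\le r<k$ let $p_{r,0}(t)$ be the probability that at time $t\ge 0$ the server is idle and $r$ customers are in the queue. Then for all $n\ge 0$ and $t\ge 0$ the elapsed time of the current service, on the event that at time $t$ the server is busy and $n$ customers are in the queue (those in service not counted), has a density $p_{n,1}(x,t)\ge 0$ in $x$, so that $$\Pr\bigl(\text{at time } t\text{: server busy, } n \text{ in queue, elapsed service time}\in E\bigr)=\int_{E\cap(0,\infty)}p_{n,1}(x,t)\,dx$$ for every Borel set $E$, and versions of these densities, defined for all $x,t\ge0$, can be chosen such that the following equations hold. For all $t\ge 0$ (derivatives at $t=0$ are one-sided) $$\frac{dp_{0,0}(t)}{dt}=-\lambda(t)p_{0,0}(t)+\mu\int_{(0,\infty)}p_{0,1}(x,t)\,dx,\tag{1}$$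 $$\frac{dp_{r,0}(t)}{dt}=-\lambda(t)p_{r,0}(t)+\lambda(t)p_{r-1,0}(t)+\mu\int_{(0,\infty)}p_{r,1}(x,t)\,dx,\qquad 1\le r<k.\tag{2}$$ For all $x,t\ge 0$ $$\Bigl(\frac{\partial}{\partial t}+\frac{\partial}{\partial x}\Bigr)p_{0,1}(x,t)=-(\lambda(t)+\mu)p_{0,1}(x,t),\tag{3}$$ $$\Bigl(\frac{\partial}{\partial t}+\frac{\partial}{\partial x}\Bigr)p_{n,1}(x,t)=-(\lambda(t)+\mu)p_{n,1}(x,t)+\lambda(t)p_{n-1,1}(x,t),\qquad n\ge 1,\tag{4}$$ where the left-hand side is the derivative $\frac{d}{dh}p_{n,1}(x+h,t+h)\big|_{h=0}$ in the direction $(1,1)$ (within $x,t\ge 0$). If moreover $\lambda$ is differentiable on $(0,\infty)$, then at all $x,t\ge 0$ with $x\ne t$ both partial derivatives of $p_{n,1}$ exist (one-sided on the axes) and (3), (4) hold for their sum. The boundary conditions hold: for all $t\ge 0$ $$p_{0,1}(0,t)=\mu\sum_{i=k}^{B}\int_{(0,\infty)}p_{i,1}(x,t)\,dx+\lambda(t)p_{k-1,0}(t),\qquad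 p_{n,1}(0,t)=\mu\int_{(0,\infty)}p_{n+B,1}(x,t)\,dx,\quad n\ge 1;\tag{5}$$ and so do the initial conditions $$p_{0,0}(0)=1,\qquad p_{r,0}(0)=0\ (1\le r\le k-1),\qquad p_{n,1}(x,0)=0\ (n\ge 0,\ x>0).\tag{6}$$ -/

import Mathlib

open MeasureTheory ProbabilityTheory Set
open scoped NNReal ENNReal

namespace BulkQueue

/-- A (non-stationary) Poisson process on `[0, ∞)` with intensity function `lam`: a counting process
with right-continuous nondecreasing paths started at `0`, with independent increments, the increment
over `(s, t]` being Poisson with parameter `∫ u in s..t, lam u`. -/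
structure IsPoissonProcess {Ω : Type*} [MeasurableSpace Ω] (lam : ℝ → ℝ)
    (N : ℝ≥0 → Ω → ℕ) (P : Measure Ω) : Prop where
  measurable : ∀ t, Measurable (N t)
  zero : ∀ ω, N 0 ω = 0
  mono : ∀ ω, Monotone fun t => N t ω
  right_continuous : ∀ ω t, ContinuousWithinAt (fun u => N u ω) (Ici t) t
  indep_increments : HasIndepIncrements N P
  law_increment : ∀ s t : ℝ≥0, s ≤ t →
    HasLaw (fun ω => N t ω - N s ω) (poissonMeasure (∫ u in (s : ℝ)..t, lam u).toNNReal) P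

/-! ### Paths of the queue

A path is driven by the counting function `a` of the arrivals (`a t` customers have arrived up to
time `t`) and by the successive service times `s 0, s 1, …`. The queue is empty and the server is
idle at time `0`. -/

/-- The first time, not before `τ`, at which at least `k` customers are in the queue, when `d`
customers have left the queue for service before; it is `∞` if there is no such time. -/
noncomputable def startTime (k : ℕ) (a : ℝ≥0 → ℕ) (τ : ℝ≥0∞) (d : ℕ) : ℝ≥0∞ :=
  ⨅ (u : ℝ≥0) (_ : τ ≤ (u : ℝ≥0∞) ∧ d + k ≤ a u), (u : ℝ≥0∞)

/-- The pair `(τ, d)`: `τ` is the completion time of the first `j` services (`0` for `j = 0`) and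
`d` is the total number of customers taken into these `j` services. A service that starts at time
`σ` takes all the customers in the queue, but at most `B` of them. -/
noncomputable def completion (k B : ℕ) (a : ℝ≥0 → ℕ) (s : ℕ → ℝ) : ℕ → ℝ≥0∞ × ℕ
  | 0 => (0, 0)
  | j + 1 =>
    let c := completion k B a s j
    let σ := startTime k a c.1 c.2
    (σ + ENNReal.ofReal (s j), min (a σ.toNNReal) (c.2 + B))

/-- The time at which service number `j` (counted from `0`) starts. -/
noncomputable def serviceStart (k B : ℕ) (a : ℝ≥0 → ℕ) (s : ℕ → ℝ) (j : ℕ) : ℝ≥0∞ :=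
  startTime k a (completion k B a s j).1 (completion k B a s j).2

/-- At time `t` the server is idle and `n` customers are in the queue: state `(n, 0)`. -/
def IdleAt (k B : ℕ) (a : ℝ≥0 → ℕ) (s : ℕ → ℝ) (t : ℝ≥0) (n : ℕ) : Prop :=
  ∃ j : ℕ, (completion k B a s j).1 ≤ t ∧ (t : ℝ≥0∞) < serviceStart k B a s j ∧
    (completion k B a s j).2 + n = a t

/-- At time `t` the server is busy, `n` customers are in the queue (those in service are not
counted) and the elapsed time of the current service is `x`: state `(n, 1)`, elapsed time `x`. -/
def BusyAt (k B : ℕ) (a : ℝ≥0 → ℕ) (s : ℕ → ℝ) (t : ℝ≥0) (n : ℕ) (x : ℝ) : Prop :=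
  ∃ j : ℕ, serviceStart k B a s j ≤ t ∧ (t : ℝ≥0∞) < (completion k B a s (j + 1)).1 ∧
    (completion k B a s (j + 1)).2 + n = a t ∧ x = (t : ℝ) - (serviceStart k B a s j).toReal

/-! ### State probabilities -/

/-- The probability that at time `t ≥ 0` the server is idle with `r` customers in the queue. -/
noncomputable def idleProb {Ω : Type*} [MeasurableSpace Ω] (P : Measure Ω) (k B : ℕ)
    (N : ℝ≥0 → Ω → ℕ) (S : ℕ → Ω → ℝ) (r : ℕ) (t : ℝ) : ℝ :=
  P.real {ω | IdleAt k B (fun u => N u ω) (fun j => S j ω) t.toNNReal r}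

/-- `p n x t` is, for every time `t ≥ 0` and every `n`, a density in `x` of the elapsed service time
on the event that at time `t` the server is busy with `n` customers in the queue. -/
structure IsBusyDensity {Ω : Type*} [MeasurableSpace Ω] (P : Measure Ω) (k B : ℕ)
    (N : ℝ≥0 → Ω → ℕ) (S : ℕ → Ω → ℝ) (p : ℕ → ℝ → ℝ → ℝ) : Prop where
  measurable : ∀ n t, 0 ≤ t → Measurable fun x => p n x t
  nonneg : ∀ n x t, 0 ≤ x → 0 ≤ t → 0 ≤ p n x t
  density : ∀ n t, 0 ≤ t → ∀ E : Set ℝ, MeasurableSet E →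
    P {ω | ∃ x ∈ E, BusyAt k B (fun u => N u ω) (fun j => S j ω) t.toNNReal n x} =
      ∫⁻ x in E ∩ Ioi 0, ENNReal.ofReal (p n x t)

/-- `(∂/∂t + ∂/∂x) f (x, t) = v` as the derivative of `f` at `(x, t)` in the direction `(1, 1)`,
within the quadrant `x, t ≥ 0` (hence one-sided at points of its boundary). -/
def HasTransportDeriv (f : ℝ → ℝ → ℝ) (v x t : ℝ) : Prop :=
  HasDerivWithinAt (fun h => f (x + h) (t + h)) v (Ici (-min x t)) 0

/-- Both partial derivatives of `f` exist at `(x, t)` (within the quadrant `x, t ≥ 0`) and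
`∂f/∂t + ∂f/∂x = v` there. -/
def HasPartialsSum (f : ℝ → ℝ → ℝ) (v x t : ℝ) : Prop :=
  ∃ ft fx : ℝ, HasDerivWithinAt (fun u => f x u) ft (Ici 0) t ∧
    HasDerivWithinAt (fun y => f y t) fx (Ici 0) x ∧ ft + fx = v

/-- The right-hand sides of the transport equations at `(x, t)`:
`-(lam t + μ) p n x t`, plus `lam t * p (n - 1) x t` if `n ≥ 1`. -/
def transportRhs (lam : ℝ → ℝ) (μ : ℝ) (p : ℕ → ℝ → ℝ → ℝ) : ℕ → ℝ → ℝ → ℝ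
  | 0, x, t => -(lam t + μ) * p 0 x t
  | n + 1, x, t => -(lam t + μ) * p (n + 1) x t + lam t * p n x t

end BulkQueue

namespace BulkQueue

/-! The pair (server flag, queue length) evolves like a Markov jump process: an exponential service
in progress has a memoryless remainder, and the arrivals after a time `t` are independent of the
arrivals before `t` and of all service times.

Forward equations. Over a short interval `(t, u]` the state is determined by the state at `t` if
nothing happens, if exactly one customer arrives, or if exactly one service ends. Everything else
(two arrivals, an arrival and a completion, or an event followed by a service shorter than `u - t`)
has probability at most the square of `L u - L t + μ (u - t)`, where `L` is the cumulated intensity;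
this is `abs_stateProb_sub_expansion_le`. Hence the state probabilities have the expected right
derivatives. These are continuous, so they are derivatives (`hasDerivWithinAt_stateProb`), and
inserting single states gives the forward equations.

The density. Let `b m` be the rate at which services start that leave `m` customers behind
(`startRate`). To be busy at time `t` with `n` in the queue and elapsed time `x`, a service must
have started at `t - x` leaving some `m ≤ n` behind, have survived for time `x`, and have seen `n -
m` arrivals. This suggests `p n x t = exp (-μ x) * ∑ m, b m (t - x) * w (n - m)` for `x ≤ t`, with
Poisson weights `w` of parameter `L t - L (t - x)`, and `0` for `x > t` (`busyDensity`). In the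
direction `(1, 1)` the factor `b m (t - x)` is constant, so the transport equations come from the
exponential and the Poisson weights alone; at `x = 0` the sum collapses to `b n t`, the boundary
condition.

Why it is the density. The event "busy with `n` in the queue, service started by time `s`" means:
busy at `s` with some `m` in the queue, no completion until `t`, and `n - m` arrivals
(`real_busy_inter_serviceStart_le`). Its probability is `exp (-μ (t - s))` times a convolution of
the busy probabilities at `s` with Poisson weights. By the forward equations, the derivative of this
expression in `s` is the proposed density at `x = t - s` (`integral_busyDensity`). So both measures
agree on half-lines (`isBusyDensity`). The case of the whole half-line identifies the busy
probabilities with the integrals of the density, which puts the forward equations into the required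
form. -/

/-- Nondecreasing right-continuous paths with values in `ℕ`. -/
structure IsCountingPath (a : ℝ≥0 → ℕ) : Prop where
  mono : Monotone a
  right_continuous : ∀ t, ContinuousWithinAt a (Ici t) t

/-! ### Deterministic paths: service times, phases, existence and uniqueness of the phase -/

section Path

lemma exists_coe_eq_of_le_coe {x : ℝ≥0∞} {t : ℝ≥0} (h : x ≤ t) : ∃ v : ℝ≥0, (v : ℝ≥0∞) = x :=
  ⟨x.toNNReal, ENNReal.coe_toNNReal (ne_top_of_le_ne_top ENNReal.coe_ne_top h)⟩

variable {k B : ℕ} {a a' : ℝ≥0 → ℕ} {s : ℕ → ℝ} {t u : ℝ≥0} {j n : ℕ}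

lemma le_startTime {τ : ℝ≥0∞} {d : ℕ} : τ ≤ startTime k a τ d :=
  le_iInf₂ fun _ h => h.1

/-- The infimum is attained: a right-continuous path with discrete values is constant on some `[t,
v)`, so a level not reached at `t` is not reached before `v`. This turns every statement about start
times into one about the path at a fixed time. -/
lemma startTime_le_iff (ha : IsCountingPath a) {τ : ℝ≥0∞} {d : ℕ} :
    startTime k a τ d ≤ t ↔ τ ≤ t ∧ d + k ≤ a t := by
  refine ⟨fun h => ⟨le_startTime.trans h, ?_⟩, fun h => iInf₂_le t h⟩
  by_contra! hlt
  have hev : ∀ᶠ u in nhdsWithin t (Ici t), a u = a t :=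
    (ha.right_continuous t).eventually (p := fun x => x = a t) (by simp [nhds_discrete])
  obtain ⟨v, hv, hsub⟩ := (mem_nhdsGE_iff_exists_Ico_subset' (u' := t + 1) (by simp)).1 hev
  have : (v : ℝ≥0∞) ≤ startTime k a τ d := by
    refine le_iInf₂ fun u hu => ?_
    by_contra! hlt'
    have huv : u < v := by exact_mod_cast hlt'
    rcases le_total t u with h1 | h1
    · have := hsub ⟨h1, huv⟩
      simp only [mem_ofPred_eq] at this
      omega
    · have := ha.mono h1
      omega
  exact absurd (this.trans h) (by simpa using hv)

lemma serviceStart_le_iff (ha : IsCountingPath a) :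
    serviceStart k B a s j ≤ t ↔
      (completion k B a s j).1 ≤ t ∧ (completion k B a s j).2 + k ≤ a t :=
  startTime_le_iff ha

lemma completion_le_serviceStart : (completion k B a s j).1 ≤ serviceStart k B a s j :=
  le_startTime

lemma completion_succ_fst :
    (completion k B a s (j + 1)).1 = serviceStart k B a s j + ENNReal.ofReal (s j) := rfl

lemma completion_succ_snd :
    (completion k B a s (j + 1)).2 =
      min (a (serviceStart k B a s j).toNNReal) ((completion k B a s j).2 + B) := rfl

lemma serviceStart_le_completion_succ :
    serviceStart k B a s j ≤ (completion k B a s (j + 1)).1 := le_self_add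

lemma monotone_completion_fst : Monotone fun j => (completion k B a s j).1 :=
  monotone_nat_of_le_succ fun _ =>
    completion_le_serviceStart.trans serviceStart_le_completion_succ

lemma completion_succ_snd_bounds (ha : IsCountingPath a) (hkB : k ≤ B)
    (h : serviceStart k B a s j ≤ t) :
    (completion k B a s (j + 1)).2 ≤ a t ∧
      (completion k B a s j).2 + k ≤ (completion k B a s (j + 1)).2 := by
  obtain ⟨v, hv⟩ := exists_coe_eq_of_le_coe h
  have h1 := ((serviceStart_le_iff (t := v) (k := k) (B := B) (s := s) (j := j) ha).1 hv.ge).2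
  rw [← hv] at h
  have h2 := ha.mono (ENNReal.coe_le_coe.1 h)
  rw [completion_succ_snd, ← hv, ENNReal.toNNReal_coe]
  omega

/-- Each service takes at least `k ≥ 1` of the customers that have arrived. Hence only finitely many
services are completed by time `t`, whatever the service times are. -/
lemma le_of_completion_fst_le (ha : IsCountingPath a) (hk : 1 ≤ k) (hkB : k ≤ B)
    (h : (completion k B a s j).1 ≤ t) : j ≤ (completion k B a s j).2 ∧
      (completion k B a s j).2 ≤ a t := by
  induction j with
  | zero => simp [completion]
  | succ j ih =>
    have h1 := serviceStart_le_completion_succ.trans h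
    have h2 := ih (completion_le_serviceStart.trans h1)
    have h3 := completion_succ_snd_bounds ha hkB h1
    omega

/-- At time `t` the path is in its idle period before service `j` (flag `false`) or in
service `j` (flag `true`), with `n` customers in the queue. -/
def InPhase (k B : ℕ) (a : ℝ≥0 → ℕ) (s : ℕ → ℝ) (t : ℝ≥0) : Bool × ℕ × ℕ → Prop
  | (false, j, n) => (completion k B a s j).1 ≤ t ∧ (t : ℝ≥0∞) < serviceStart k B a s j ∧
      (completion k B a s j).2 + n = a t
  | (true, j, n) => serviceStart k B a s j ≤ t ∧ (t : ℝ≥0∞) < (completion k B a s (j + 1)).1 ∧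
      (completion k B a s (j + 1)).2 + n = a t

lemma InPhase.mem_cycle {z : Bool × ℕ × ℕ} (h : InPhase k B a s t z) :
    (completion k B a s z.2.1).1 ≤ t ∧ (t : ℝ≥0∞) < (completion k B a s (z.2.1 + 1)).1 := by
  obtain ⟨_ | _, j, n⟩ := z
  · exact ⟨h.1, h.2.1.trans_le serviceStart_le_completion_succ⟩
  · exact ⟨completion_le_serviceStart.trans h.1, h.2.1⟩

lemma InPhase.unique {z z' : Bool × ℕ × ℕ} (h : InPhase k B a s t z)
    (h' : InPhase k B a s t z') : z = z' := by
  have hj : z.2.1 = z'.2.1 := by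
    by_contra hne
    rcases lt_or_gt_of_ne hne with hlt | hlt
    · exact absurd ((h.mem_cycle.2.trans_le (monotone_completion_fst hlt)).trans_le
        h'.mem_cycle.1) (lt_irrefl _)
    · exact absurd ((h'.mem_cycle.2.trans_le (monotone_completion_fst hlt)).trans_le
        h.mem_cycle.1) (lt_irrefl _)
  obtain ⟨b, j, n⟩ := z
  obtain ⟨b', j', n'⟩ := z'
  obtain rfl : j = j' := hj
  cases b <;> cases b' <;> simp only [InPhase] at h h'
  · simp only [Prod.mk.injEq, true_and]
    omega
  · exact absurd (h.2.1.trans_le h'.1) (lt_irrefl _)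
  · exact absurd (h'.2.1.trans_le h.1) (lt_irrefl _)
  · simp only [Prod.mk.injEq, true_and]
    omega

/-- If `t` lay in no cycle, then by induction every completion time would be at most `t`,
contradicting the bound on the number of completed services. -/
lemma exists_inPhase (ha : IsCountingPath a) (hk : 1 ≤ k) (hkB : k ≤ B) (s : ℕ → ℝ) (t : ℝ≥0) :
    ∃ z, InPhase k B a s t z := by
  by_contra! hno
  have hle : ∀ j, (completion k B a s j).1 ≤ t := by
    intro j
    induction j with
    | zero => simp [completion]
    | succ j ih =>
      have h1 : serviceStart k B a s j ≤ t := by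
        by_contra! h1
        refine hno (false, j, a t - (completion k B a s j).2) ⟨ih, h1, ?_⟩
        have := (le_of_completion_fst_le ha hk hkB ih).2
        omega
      by_contra! h2
      refine hno (true, j, a t - (completion k B a s (j + 1)).2) ⟨h1, h2, ?_⟩
      have := (completion_succ_snd_bounds ha hkB h1).1
      omega
  have := le_of_completion_fst_le ha hk hkB (hle (a t + 1))
  omega

/-- The phase of the path at time `t`: flag of the server, number of the current or next service,
length of the queue. -/
noncomputable def phase (k B : ℕ) (a : ℝ≥0 → ℕ) (s : ℕ → ℝ) (t : ℝ≥0) : Bool × ℕ × ℕ :=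
  Classical.epsilon (InPhase k B a s t)

lemma phase_eq_iff (ha : IsCountingPath a) (hk : 1 ≤ k) (hkB : k ≤ B) {z : Bool × ℕ × ℕ} :
    phase k B a s t = z ↔ InPhase k B a s t z := by
  have hspec : InPhase k B a s t (phase k B a s t) :=
    Classical.epsilon_spec (exists_inPhase ha hk hkB s t)
  exact ⟨fun h => h ▸ hspec, fun h => hspec.unique h⟩

/-! ### Evolution of a path after time `t` -/

lemma InPhase.busy_of_lt_completion (ha : IsCountingPath a)
    (h : InPhase k B a s t (true, j, n)) (htu : t ≤ u)
    (hu : (u : ℝ≥0∞) < (completion k B a s (j + 1)).1) :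
    InPhase k B a s u (true, j, n + (a u - a t)) := by
  refine ⟨h.1.trans (by exact_mod_cast htu), hu, ?_⟩
  have := h.2.2
  have := ha.mono htu
  omega

lemma InPhase.busy_of_serviceStart_le (ha : IsCountingPath a) (hkB : k ≤ B)
    (h : InPhase k B a s u (true, j, n)) (htu : t ≤ u) (ht : serviceStart k B a s j ≤ t) :
    ∃ m, InPhase k B a s t (true, j, m) ∧ m + (a u - a t) = n := by
  have h1 := (completion_succ_snd_bounds ha hkB ht).1
  refine ⟨a t - (completion k B a s (j + 1)).2, ⟨ht, ?_, by omega⟩, ?_⟩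
  · exact lt_of_le_of_lt (by exact_mod_cast htu) h.2.1
  · have := h.2.2
    have := ha.mono htu
    omega

/-- The bound on `s (j + 1)` excludes a second completion: a service that starts after `t` and lasts
longer than `u - t` is still going on at `u`. The truncated difference `n - B` covers full batches
as well as batches that empty the queue. -/
lemma InPhase.after_completion (ha : IsCountingPath a)
    (h : InPhase k B a s t (true, j, n)) (hu : (completion k B a s (j + 1)).1 ≤ u)
    (hau : a u = a t) (hs : (u : ℝ) - t < s (j + 1)) :
    InPhase k B a s u (if n < k then (false, j + 1, n) else (true, j + 1, n - B)) := by
  have h2 := h.2.2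
  split_ifs with hnk
  · refine ⟨hu, ?_, by omega⟩
    rw [← not_le, serviceStart_le_iff ha]
    omega
  · have hstart : serviceStart k B a s (j + 1) ≤ u := (serviceStart_le_iff ha).2 ⟨hu, by omega⟩
    obtain ⟨v, hv⟩ := exists_coe_eq_of_le_coe hstart
    have htv : t < v := by
      have := h.2.1.trans_le (completion_le_serviceStart.trans hv.ge)
      exact_mod_cast this
    have hvu : v ≤ u := by rw [← hv] at hstart; exact_mod_cast hstart
    refine ⟨hstart, ?_, ?_⟩
    · rw [completion_succ_fst, ← hv, ENNReal.ofReal, ← ENNReal.coe_add, ENNReal.coe_lt_coe,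
        ← NNReal.coe_lt_coe, NNReal.coe_add]
      have h3 : s (j + 1) ≤ (s (j + 1)).toNNReal := Real.le_coe_toNNReal _
      have h4 : (t : ℝ) < v := htv
      linarith
    · have h3 := ha.mono htv.le
      have h4 := ha.mono hvu
      rw [completion_succ_snd, ← hv, ENNReal.toNNReal_coe]
      omega

lemma InPhase.idle_lt (ha : IsCountingPath a) (h : InPhase k B a s t (false, j, n)) : n < k := by
  have h1 := h.2.1
  rw [← not_le, serviceStart_le_iff ha, not_and, not_le] at h1
  have := h1 h.1
  have := h.2.2
  omega

lemma InPhase.idle_of_lt (ha : IsCountingPath a)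
    (h : InPhase k B a s t (false, j, n)) (htu : t ≤ u) (hn : n + (a u - a t) < k) :
    InPhase k B a s u (false, j, n + (a u - a t)) := by
  have h2 := h.2.2
  have := ha.mono htu
  refine ⟨h.1.trans (by exact_mod_cast htu), ?_, by omega⟩
  rw [← not_le, serviceStart_le_iff ha]
  omega

/-- The arriving customer is the `k`-th one and triggers a service; since `k ≤ B`, nobody is left in
the queue. The bound on `s j` keeps this service running until `u`. -/
lemma InPhase.busy_of_arrival (ha : IsCountingPath a) (hkB : k ≤ B)
    (h : InPhase k B a s t (false, j, n)) (htu : t ≤ u) (hn : n + 1 = k) (hau : a u - a t = 1)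
    (hs : (u : ℝ) - t < s j) : InPhase k B a s u (true, j, 0) := by
  have h2 := h.2.2
  have hstart : serviceStart k B a s j ≤ u :=
    (serviceStart_le_iff ha).2 ⟨h.1.trans (by exact_mod_cast htu), by omega⟩
  obtain ⟨v, hv⟩ := exists_coe_eq_of_le_coe hstart
  have htv : t < v := by
    have := h.2.1
    rw [← hv] at this
    exact_mod_cast this
  have hvu : v ≤ u := by rw [← hv] at hstart; exact_mod_cast hstart
  refine ⟨hstart, ?_, ?_⟩
  · rw [completion_succ_fst, ← hv, ENNReal.ofReal, ← ENNReal.coe_add, ENNReal.coe_lt_coe,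
      ← NNReal.coe_lt_coe, NNReal.coe_add]
    have h3 : s j ≤ (s j).toNNReal := Real.le_coe_toNNReal _
    have h4 : (t : ℝ) < v := htv
    linarith
  · have h3 := ((serviceStart_le_iff (t := v) (k := k) (B := B) (s := s) (j := j) ha).1 hv.ge).2
    have h4 := ha.mono hvu
    rw [completion_succ_snd, ← hv, ENNReal.toNNReal_coe]
    omega

/-! ### Dependence on the arrivals up to time `t` only -/

/-- The path frozen at `t` is a function of the history up to `t`. As the phase at `t` does not
distinguish it from the original path, the phase is measurable with respect to that history. -/
lemma IsCountingPath.stopped (ha : IsCountingPath a) (t : ℝ≥0) :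
    IsCountingPath fun v => a (min v t) where
  mono _ _ h := ha.mono (min_le_min_right t h)
  right_continuous v := (ha.right_continuous (min v t)).comp
    (t := Ici (min v t)) (f := fun w => min w t) (by fun_prop)
    fun _ hw => min_le_min_right t hw

/-- Beyond `t` the two paths may differ, so equality of all start and completion times fails. What
passes from one service to the next is an alternative: the values agree, or both lie after `t`. -/
lemma serviceStart_congr_of_completion (ha : IsCountingPath a) (ha' : IsCountingPath a')
    (h : ∀ v ≤ t, a v = a' v)
    (hc : completion k B a s j = completion k B a' s j ∨
      (t : ℝ≥0∞) < (completion k B a s j).1 ∧ (t : ℝ≥0∞) < (completion k B a' s j).1) :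
    serviceStart k B a s j = serviceStart k B a' s j ∧ serviceStart k B a s j ≤ t ∧
        completion k B a s j = completion k B a' s j ∨
      (t : ℝ≥0∞) < serviceStart k B a s j ∧ (t : ℝ≥0∞) < serviceStart k B a' s j := by
  rcases hc with hc | hc
  · have hiff : ∀ v ≤ t, serviceStart k B a s j ≤ v ↔ serviceStart k B a' s j ≤ v := by
      intro v hv
      rw [serviceStart_le_iff ha, serviceStart_le_iff ha', hc, h v hv]
    by_cases hle : serviceStart k B a s j ≤ t
    · refine Or.inl ⟨?_, hle, hc⟩
      have hle' := (hiff t le_rfl).1 hle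
      obtain ⟨v, hv⟩ := exists_coe_eq_of_le_coe hle
      obtain ⟨v', hv'⟩ := exists_coe_eq_of_le_coe (hle')
      rw [← hv] at hle
      rw [← hv'] at hle'
      have h1 := (hiff v (by exact_mod_cast hle)).1 hv.ge
      have h2 := (hiff v' (by exact_mod_cast hle')).2 hv'.ge
      exact le_antisymm (h2.trans hv'.le) (h1.trans hv.le)
    · refine Or.inr ⟨not_le.1 hle, not_le.1 ?_⟩
      rwa [← hiff t le_rfl]
  · exact Or.inr ⟨hc.1.trans_le completion_le_serviceStart, hc.2.trans_le completion_le_serviceStart⟩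

lemma completion_congr (ha : IsCountingPath a) (ha' : IsCountingPath a')
    (h : ∀ v ≤ t, a v = a' v) (s : ℕ → ℝ) (j : ℕ) :
    completion k B a s j = completion k B a' s j ∨
      (t : ℝ≥0∞) < (completion k B a s j).1 ∧ (t : ℝ≥0∞) < (completion k B a' s j).1 := by
  induction j with
  | zero => exact Or.inl rfl
  | succ j ih =>
    rcases serviceStart_congr_of_completion ha ha' h ih with ⟨h1, h2, h3⟩ | h1
    · refine Or.inl (Prod.ext ?_ ?_)
      · rw [completion_succ_fst, completion_succ_fst, h1]
      · have h4 : (serviceStart k B a s j).toNNReal ≤ t :=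
          by
          simpa using ENNReal.toNNReal_mono ENNReal.coe_ne_top h2
        rw [completion_succ_snd, completion_succ_snd, ← h1, h _ h4, h3]
    · exact Or.inr ⟨h1.1.trans_le serviceStart_le_completion_succ,
        h1.2.trans_le serviceStart_le_completion_succ⟩

lemma serviceStart_congr (ha : IsCountingPath a) (ha' : IsCountingPath a')
    (h : ∀ v ≤ t, a v = a' v) (s : ℕ → ℝ) (j : ℕ) :
    serviceStart k B a s j = serviceStart k B a' s j ∧
        completion k B a s (j + 1) = completion k B a' s (j + 1) ∨
      (t : ℝ≥0∞) < serviceStart k B a s j ∧ (t : ℝ≥0∞) < serviceStart k B a' s j := by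
  rcases serviceStart_congr_of_completion ha ha' h (completion_congr ha ha' h s j)
    with ⟨h1, h2, h3⟩ | h1
  · refine Or.inl ⟨h1, Prod.ext ?_ ?_⟩
    · rw [completion_succ_fst, completion_succ_fst, h1]
    · have h4 : (serviceStart k B a s j).toNNReal ≤ t :=
          by
          simpa using ENNReal.toNNReal_mono ENNReal.coe_ne_top h2
      rw [completion_succ_snd, completion_succ_snd, ← h1, h _ h4, h3]
  · exact Or.inr h1

lemma inPhase_of_congr (ha : IsCountingPath a) (ha' : IsCountingPath a')
    (h : ∀ v ≤ t, a v = a' v) {z : Bool × ℕ × ℕ} (hz : InPhase k B a s t z) :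
    InPhase k B a' s t z ∧ (z.1 = true →
      completion k B a s (z.2.1 + 1) = completion k B a' s (z.2.1 + 1)) := by
  obtain ⟨_ | _, j, n⟩ := z
  · rcases completion_congr (k := k) (B := B) ha ha' h s j with h1 | h1
    · refine ⟨⟨h1 ▸ hz.1, ?_, by rw [← h1, ← h t le_rfl]; exact hz.2.2⟩, by simp⟩
      have := hz.2.1
      rw [← not_le, serviceStart_le_iff ha] at this
      rwa [← not_le, serviceStart_le_iff ha', ← h1, ← h t le_rfl]
    · exact absurd (hz.1.trans_lt h1.1) (lt_irrefl _)
  · rcases serviceStart_congr (k := k) (B := B) ha ha' h s j with ⟨h1, h2⟩ | h1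
    · exact ⟨⟨h1 ▸ hz.1, h2 ▸ hz.2.1, by rw [← h2, ← h t le_rfl]; exact hz.2.2⟩, fun _ => h2⟩
    · exact absurd (hz.1.trans_lt h1.1) (lt_irrefl _)

end Path

/-! ### Measurability -/

section Measurability

variable {Ω : Type*} {m : MeasurableSpace Ω} {k B : ℕ} {A : ℝ≥0 → Ω → ℕ} {s : ℕ → Ω → ℝ}

/-- The σ-algebra `m` is left free because the measurability lemmas are applied to the full
σ-algebra and also to the sub-σ-algebras on which the independence arguments rest. -/
lemma measurable_startTime (hA : ∀ t, Measurable[m] (A t))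
    (hpath : ∀ ω, IsCountingPath fun t => A t ω) {τ : Ω → ℝ≥0∞} {d : Ω → ℕ}
    (hτ : Measurable[m] τ) (hd : Measurable[m] d) :
    Measurable[m] fun ω => startTime k (fun t => A t ω) (τ ω) (d ω) := by
  refine measurable_of_Iic fun x => ?_
  induction x with
  | top => simp
  | coe t =>
    have : (fun ω => startTime k (fun t => A t ω) (τ ω) (d ω)) ⁻¹' Iic (t : ℝ≥0∞) =
        {ω | τ ω ≤ t} ∩ {ω | d ω + k ≤ A t ω} := by
      ext ω
      exact startTime_le_iff (hpath ω)
    rw [this]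
    exact (measurableSet_le hτ measurable_const).inter
      (measurableSet_le (hd.add_const k) (hA t))

/-- At least `r` customers have arrived by the random time exactly if the first time at which the
count reaches `r` is not later. -/
lemma measurable_eval_random_time (hA : ∀ t, Measurable[m] (A t))
    (hpath : ∀ ω, IsCountingPath fun t => A t ω) {f : Ω → ℝ≥0} (hf : Measurable[m] f) :
    Measurable[m] fun ω => A (f ω) ω := by
  refine measurable_of_Ici fun r => ?_
  have : (fun ω => A (f ω) ω) ⁻¹' Ici r =
      {ω | startTime r (fun t => A t ω) 0 0 ≤ (f ω : ℝ≥0∞)} := by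
    ext ω
    simp [startTime_le_iff (hpath ω)]
  rw [this]
  exact measurableSet_le (measurable_startTime hA hpath measurable_const measurable_const)
    hf.coe_nnreal_ennreal

lemma measurable_serviceStart_of_completion (hA : ∀ t, Measurable[m] (A t))
    (hpath : ∀ ω, IsCountingPath fun t => A t ω) {j : ℕ}
    (hc : Measurable[m] fun ω => completion k B (fun t => A t ω) (fun i => s i ω) j) :
    Measurable[m] fun ω => serviceStart k B (fun t => A t ω) (fun i => s i ω) j :=
  measurable_startTime hA hpath hc.fst hc.snd

/-- The size of batch `j` is fixed when its service starts, so it involves no service time from `s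
j` on. This is what makes it independent of `s j`. -/
lemma measurable_completion_succ_snd (hA : ∀ t, Measurable[m] (A t))
    (hpath : ∀ ω, IsCountingPath fun t => A t ω) {j : ℕ}
    (hc : Measurable[m] fun ω => completion k B (fun t => A t ω) (fun i => s i ω) j) :
    Measurable[m] fun ω => (completion k B (fun t => A t ω) (fun i => s i ω) (j + 1)).2 :=
  (measurable_eval_random_time hA hpath
    (measurable_serviceStart_of_completion hA hpath hc).ennreal_toNNReal).min
      (hc.snd.add_const B)

lemma measurable_completion (hA : ∀ t, Measurable[m] (A t))
    (hpath : ∀ ω, IsCountingPath fun t => A t ω) {j : ℕ} (hs : ∀ i < j, Measurable[m] (s i)) :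
    Measurable[m] fun ω => completion k B (fun t => A t ω) (fun i => s i ω) j := by
  induction j with
  | zero => exact measurable_const
  | succ j ih =>
    have hc := ih fun i hi => hs i (by omega)
    exact ((measurable_serviceStart_of_completion hA hpath hc).add
      (hs j (by omega)).ennreal_ofReal).prodMk (measurable_completion_succ_snd hA hpath hc)

lemma measurable_serviceStart (hA : ∀ t, Measurable[m] (A t))
    (hpath : ∀ ω, IsCountingPath fun t => A t ω) {j : ℕ} (hs : ∀ i < j, Measurable[m] (s i)) :
    Measurable[m] fun ω => serviceStart k B (fun t => A t ω) (fun i => s i ω) j :=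
  measurable_serviceStart_of_completion hA hpath (measurable_completion hA hpath hs)

/-- Separated from the busy case because the idle period before service `j` involves only the
service times before `s j`. -/
lemma measurableSet_inPhase_idle (hA : ∀ t, Measurable[m] (A t))
    (hpath : ∀ ω, IsCountingPath fun t => A t ω) {j : ℕ} (hs : ∀ i < j, Measurable[m] (s i))
    (t : ℝ≥0) (n : ℕ) :
    MeasurableSet[m] {ω | InPhase k B (fun t => A t ω) (fun i => s i ω) t (false, j, n)} := by
  have hc := measurable_completion (k := k) (B := B) hA hpath hs
  have hσ := measurable_serviceStart (k := k) (B := B) hA hpath hs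
  exact (measurableSet_le hc.fst measurable_const).inter
    ((measurableSet_lt measurable_const hσ).inter
      (measurableSet_eq_fun (hc.snd.add_const n) (hA t)))

lemma measurableSet_inPhase (hA : ∀ t, Measurable[m] (A t))
    (hpath : ∀ ω, IsCountingPath fun t => A t ω) (z : Bool × ℕ × ℕ)
    (hs : ∀ i < z.2.1 + 1, Measurable[m] (s i)) (t : ℝ≥0) :
    MeasurableSet[m] {ω | InPhase k B (fun t => A t ω) (fun i => s i ω) t z} := by
  obtain ⟨_ | _, j, n⟩ := z
  · exact measurableSet_inPhase_idle hA hpath (fun i hi => hs i (by simp; omega)) t n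
  · have hc := measurable_completion (k := k) (B := B) hA hpath hs
    have hσ := measurable_serviceStart (k := k) (B := B) (j := j) hA hpath
      fun i hi => hs i (by simp; omega)
    exact (measurableSet_le hσ measurable_const).inter
      ((measurableSet_lt measurable_const hc.fst).inter
        (measurableSet_eq_fun (hc.snd.add_const n) (hA t)))

lemma measurable_phase (hk : 1 ≤ k) (hkB : k ≤ B) (hA : ∀ t, Measurable[m] (A t))
    (hpath : ∀ ω, IsCountingPath fun t => A t ω) (hs : ∀ i, Measurable[m] (s i)) (t : ℝ≥0) :
    Measurable[m] fun ω => phase k B (fun t => A t ω) (fun i => s i ω) t := by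
  refine measurable_to_countable' fun z => ?_
  convert measurableSet_inPhase (k := k) (B := B) hA hpath z (fun i _ => hs i) t using 1
  ext ω
  exact phase_eq_iff (hpath ω) hk hkB

end Measurability

/-! ### Independence of past and future; the exponential distribution -/

section Independence

variable {Ω : Type*} {m mΩ : MeasurableSpace Ω} {P : Measure Ω} [IsProbabilityMeasure P]

/-- Intersections of a set from `m₁` with a set from `m₂` form a π-system generating `m₁ ⊔ m₂`; on
it the probabilities factor by using the two independences in turn. -/
lemma indep_sup_left_of_indep {m₁ m₂ m₃ : MeasurableSpace Ω} (h₁ : m₁ ≤ mΩ) (h₂ : m₂ ≤ mΩ)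
    (h₃ : m₃ ≤ mΩ) (h : Indep m₁ (m₂ ⊔ m₃) P) (h' : Indep m₂ m₃ P) : Indep (m₁ ⊔ m₂) m₃ P := by
  set p : Set (Set Ω) := image2 (· ∩ ·) {s | MeasurableSet[m₁] s} {s | MeasurableSet[m₂] s}
  have hgen : m₁ ⊔ m₂ = MeasurableSpace.generateFrom p := by
    refine le_antisymm (sup_le (fun s hs => ?_) (fun s hs => ?_))
      (MeasurableSpace.generateFrom_le ?_)
    · exact MeasurableSpace.measurableSet_generateFrom
        ⟨s, hs, univ, MeasurableSet.univ, inter_univ s⟩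
    · exact MeasurableSpace.measurableSet_generateFrom
        ⟨univ, MeasurableSet.univ, s, hs, univ_inter s⟩
    · rintro _ ⟨s, hs, r, hr, rfl⟩
      exact MeasurableSet.inter ((le_sup_left : m₁ ≤ m₁ ⊔ m₂) s hs)
        ((le_sup_right : m₂ ≤ m₁ ⊔ m₂) r hr)
  rw [hgen, ← @MeasurableSpace.generateFrom_measurableSet _ m₃]
  refine IndepSets.indep' ?_ (fun s hs => h₃ s hs) ?_ ?_ ?_
  · rintro _ ⟨s, hs, r, hr, rfl⟩
    exact (h₁ s hs).inter (h₂ r hr)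
  · rintro _ ⟨s, hs, r, hr, rfl⟩ _ ⟨s', hs', r', hr', rfl⟩ _
    exact ⟨s ∩ s', MeasurableSet.inter hs hs', r ∩ r', MeasurableSet.inter hr hr',
      inter_inter_inter_comm _ _ _ _⟩
  · exact @MeasurableSpace.isPiSystem_measurableSet _ m₃
  · rw [IndepSets_iff]
    rintro _ c ⟨s, hs, r, hr, rfl⟩ hc
    rw [Indep_iff] at h h'
    have e1 := h s (r ∩ c) hs (MeasurableSet.inter ((le_sup_left : m₂ ≤ m₂ ⊔ m₃) r hr)
      ((le_sup_right : m₃ ≤ m₂ ⊔ m₃) c hc))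
    have e2 := h s r hs ((le_sup_left : m₂ ≤ m₂ ⊔ m₃) r hr)
    have e3 := h' r c hr hc
    simp only
    rw [inter_assoc, e1, e2, e3, mul_assoc]

/-- The σ-algebra generated by the values `N v`, `v ≤ t`. -/
@[reducible] def history (N : ℝ≥0 → Ω → ℕ) (t : ℝ≥0) : MeasurableSpace Ω :=
  ⨆ v : ℝ≥0, MeasurableSpace.comap (N (min v t)) inferInstance

variable {N : ℝ≥0 → Ω → ℕ}

omit [IsProbabilityMeasure P] in
lemma indep_finite_history (hN : ∀ t, Measurable (N t)) (h0 : ∀ ω, N 0 ω = 0)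
    (hmono : ∀ ω, Monotone fun t => N t ω) (hinc : HasIndepIncrements N P) {t u : ℝ≥0}
    (htu : t ≤ u) (J : Finset ℝ≥0) (hJ : ∀ v ∈ J, v ≤ t) :
    Indep (⨆ v ∈ J, MeasurableSpace.comap (N v) inferInstance)
      (MeasurableSpace.comap (fun ω => N u ω - N t ω) inferInstance) P := by
  -- The grid is `0`, then the points of `J` in increasing order, then `t`, then `u` forever. The
  -- increment over `(t, u]` has index `J.card + 1`.
  let τ : ℕ → ℝ≥0
    | 0 => 0
    | i + 1 => if h : i < J.card then J.orderEmbOfFin rfl ⟨i, h⟩ else if i = J.card then t else u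
  have hτ : Monotone τ := by
    refine monotone_nat_of_le_succ fun i => ?_
    cases i with
    | zero => exact zero_le
    | succ i =>
      simp only [τ]
      split_ifs with h1 h2 h2 h3 h3 h4 h4
      · exact (J.orderEmbOfFin rfl).monotone (by simp)
      · exact hJ _ (Finset.orderEmbOfFin_mem _ _ _)
      · exact (hJ _ (Finset.orderEmbOfFin_mem _ _ _)).trans htu
      all_goals first | omega | exact htu | exact le_rfl
  have hi := hinc.nat hτ
  rw [iIndepFun_iff_iIndep] at hi
  have hmeas : ∀ i, Measurable fun ω => N (τ (i + 1)) ω - N (τ i) ω :=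
    fun i => (hN _).sub (hN _)
  have := indep_iSup_of_disjoint (fun i => (hmeas i).comap_le) hi
    (S := Iio (J.card + 1)) (T := {J.card + 1}) (by simp)
  refine indep_of_indep_of_le this ?_ ?_
  -- As `N 0 = 0`, each value on the grid up to `t` is a sum of earlier increments; by monotonicity
  -- the truncated subtraction loses nothing.
  · have key : ∀ i ≤ J.card + 1, Measurable[⨆ i ∈ Iio (J.card + 1), MeasurableSpace.comap
        (fun ω => N (τ (i + 1)) ω - N (τ i) ω) inferInstance] (N (τ i)) := by
      intro i
      induction i with
      | zero =>
        intro _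
        have : N (τ 0) = fun _ => 0 := funext h0
        rw [this]
        exact measurable_const
      | succ i ih =>
        intro hi
        have e : N (τ (i + 1)) = fun ω => N (τ i) ω + (N (τ (i + 1)) ω - N (τ i) ω) := by
          funext ω
          have := hmono ω (hτ (Nat.le_succ i))
          simp only [Nat.succ_eq_add_one] at this
          omega
        rw [e]
        refine (ih (by omega)).add (Measurable.mono (comap_measurable _) ?_ le_rfl)
        exact le_iSup₂ (f := fun (i : ℕ) (_ : i ∈ Iio (J.card + 1)) => MeasurableSpace.comap
          (fun ω => N (τ (i + 1)) ω - N (τ i) ω) inferInstance) i (by simp; omega)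
    refine iSup₂_le fun v hv => ?_
    have : v ∈ range (J.orderEmbOfFin rfl) := by simpa using hv
    obtain ⟨i, rfl⟩ := this
    have := key (i + 1) (by omega)
    simp only [τ, i.2, dite_true] at this
    exact this.comap_le
  · refine le_iSup₂_of_le (J.card + 1) rfl ?_
    simp [τ]

/-- The history is the directed supremum of the σ-algebras generated by finitely many values, and
independence passes to directed suprema. -/
lemma indep_history (hN : ∀ t, Measurable (N t)) (h0 : ∀ ω, N 0 ω = 0)
    (hmono : ∀ ω, Monotone fun t => N t ω) (hinc : HasIndepIncrements N P) {t u : ℝ≥0}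
    (htu : t ≤ u) :
    Indep (history N t) (MeasurableSpace.comap (fun ω => N u ω - N t ω) inferInstance) P := by
  have : history N t = ⨆ I : Finset ℝ≥0, ⨆ v ∈ I, MeasurableSpace.comap (N (min v t)) inferInstance :=
    iSup_eq_iSup_finset _
  rw [this]
  have hle : ∀ I : Finset ℝ≥0, ⨆ v ∈ I, MeasurableSpace.comap (N (min v t)) inferInstance ≤ mΩ :=
    fun I => iSup₂_le fun v _ => (hN _).comap_le
  refine indep_iSup_of_directed_le (fun I => ?_) hle ((hN u).sub (hN t)).comap_le ?_
  · have := indep_finite_history hN h0 hmono hinc htu (I.image fun v => min v t) (by simp)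
    rwa [Finset.iSup_finset_image] at this
  · refine Monotone.directed_le fun I I' hII' => ?_
    exact biSup_mono fun v hv => hII' hv

omit [IsProbabilityMeasure P] in
-- Summation over the countably many values of `Z`. With `Z` the phase, it reduces claims about the
-- service with a random number to a fixed number, where independence is available.
lemma measure_preimage_inter_eq_mul {β : Type*} [Countable β] {Z : Ω → β}
    (hZ : ∀ z, MeasurableSet (Z ⁻¹' {z})) {V W : Set Ω} {Q : Set β} {c : ℝ≥0∞}
    (h : ∀ z ∈ Q, P (Z ⁻¹' {z} ∩ V) = c * P (Z ⁻¹' {z} ∩ W)) :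
    P (Z ⁻¹' Q ∩ V) = c * P (Z ⁻¹' Q ∩ W) := by
  have hQ : MeasurableSet (Z ⁻¹' Q) := by
    rw [← biUnion_of_singleton Q, preimage_iUnion₂]
    exact MeasurableSet.biUnion (to_countable Q) fun z _ => hZ z
  rw [← Measure.restrict_apply hQ, ← Measure.restrict_apply hQ,
    ← tsum_measure_preimage_singleton (to_countable Q) fun z _ => hZ z,
    ← tsum_measure_preimage_singleton (to_countable Q) fun z _ => hZ z, ← ENNReal.tsum_mul_left]
  refine tsum_congr fun z => ?_
  rw [Measure.restrict_apply (hZ z), Measure.restrict_apply (hZ z), h z z.2]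

lemma expMeasure_Iic {μ : ℝ} (hμ : 0 < μ) {c : ℝ} (hc : 0 ≤ c) :
    expMeasure μ (Iic c) = ENNReal.ofReal (1 - Real.exp (-(μ * c))) := by
  have := isProbabilityMeasure_expMeasure hμ
  rw [← ofReal_cdf, cdf_expMeasure_eq hμ, if_pos hc]

lemma expMeasure_Ioi {μ : ℝ} (hμ : 0 < μ) {c : ℝ} (hc : 0 ≤ c) :
    expMeasure μ (Ioi c) = ENNReal.ofReal (Real.exp (-(μ * c))) := by
  have := isProbabilityMeasure_expMeasure hμ
  rw [← compl_Iic, prob_compl_eq_one_sub measurableSet_Iic, expMeasure_Iic hμ hc,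
    ← ENNReal.ofReal_one, ← ENNReal.ofReal_sub]
  · congr 1
    ring
  · rw [sub_nonneg, Real.exp_le_one_iff]
    have := mul_nonneg hμ.le hc
    linarith

/-- Memorylessness of the exponential distribution at an independent time. -/
lemma measure_inter_lt_exp_of_indep {μ : ℝ} (hμ : 0 < μ) {X : Ω → ℝ} (hX : Measurable X)
    (hlaw : HasLaw X (expMeasure μ) P) (hm : m ≤ mΩ)
    (hind : Indep m (MeasurableSpace.comap X inferInstance) P) {E : Set Ω}
    (hE : MeasurableSet[m] E) {T : Ω → ℝ≥0} (hT : Measurable[m] T) (h : ℝ≥0) :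
    P (E ∩ {ω | (T ω : ℝ) + h < X ω}) =
      ENNReal.ofReal (Real.exp (-(μ * h))) * P (E ∩ {ω | (T ω : ℝ) < X ω}) := by
  have := isProbabilityMeasure_expMeasure hμ
  -- Recording `T` together with membership in `E` gives one variable independent of `X`. By Fubini
  -- the probability is the integral over `E` of `exp (-μ (T + h))`, from which `exp (-μ h)` splits
  -- off.
  let Z : Ω → ℝ≥0 × Prop := fun ω => (T ω, ω ∈ E)
  have hZm : Measurable[m] Z := hT.prodMk ((@measurable_mem Ω E m).2 hE)
  have hZ : Measurable Z := hZm.mono hm le_rfl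
  have hZX : IndepFun Z X P := by
    rw [IndepFun_iff_Indep]
    exact indep_of_indep_of_le_left hind hZm.comap_le
  rw [indepFun_iff_map_prod_eq_prod_map_map hZ.aemeasurable hX.aemeasurable, hlaw.map_eq] at hZX
  have key : ∀ h : ℝ≥0, P (E ∩ {ω | (T ω : ℝ) + h < X ω}) =
      ∫⁻ z, ENNReal.ofReal (Real.exp (-(μ * h))) *
        {z : ℝ≥0 × Prop | z.2}.indicator
          (fun z => ENNReal.ofReal (Real.exp (-(μ * z.1)))) z ∂(P.map Z) := by
    intro h
    have hset : MeasurableSet {p : (ℝ≥0 × Prop) × ℝ | p.1.2 ∧ (p.1.1 : ℝ) + h < p.2} :=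
      (measurableSet_setOfPred.2 (measurable_snd.comp measurable_fst)).inter
        (measurableSet_lt (f := fun p : (ℝ≥0 × Prop) × ℝ => (p.1.1 : ℝ) + h)
          (g := fun p : (ℝ≥0 × Prop) × ℝ => p.2) (by fun_prop) (by fun_prop))
    have : E ∩ {ω | (T ω : ℝ) + h < X ω} = (fun ω => (Z ω, X ω)) ⁻¹'
        {p : (ℝ≥0 × Prop) × ℝ | p.1.2 ∧ (p.1.1 : ℝ) + h < p.2} := rfl
    rw [this, ← Measure.map_apply (hZ.prodMk hX) hset, hZX, Measure.prod_apply hset]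
    refine lintegral_congr fun z => ?_
    by_cases hz : z.2
    · have : Prod.mk z ⁻¹' {p : (ℝ≥0 × Prop) × ℝ | p.1.2 ∧ (p.1.1 : ℝ) + h < p.2} =
          Ioi ((z.1 : ℝ) + h) := by
        ext x
        simp [hz]
      rw [this, expMeasure_Ioi hμ (by positivity),
        indicator_of_mem (show z ∈ {z : ℝ≥0 × Prop | z.2} from hz),
        ← ENNReal.ofReal_mul (by positivity),
        ← Real.exp_add]
      congr 2
      ring
    · have : Prod.mk z ⁻¹' {p : (ℝ≥0 × Prop) × ℝ | p.1.2 ∧ (p.1.1 : ℝ) + h < p.2} = ∅ := by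
        ext x
        simp [hz]
      rw [this, indicator_of_notMem (show z ∉ {z : ℝ≥0 × Prop | z.2} from hz)]
      simp
  have k0 := key 0
  simp only [NNReal.coe_zero, add_zero, mul_zero, neg_zero, Real.exp_zero, ENNReal.ofReal_one,
    one_mul] at k0
  rw [key h, k0, lintegral_const_mul' _ _ ENNReal.ofReal_ne_top]

omit [IsProbabilityMeasure P] in
lemma measure_inter_exp_le_of_indep {μ : ℝ} (hμ : 0 < μ) {X : Ω → ℝ}
    (hlaw : HasLaw X (expMeasure μ) P)
    (hind : Indep m (MeasurableSpace.comap X inferInstance) P) {E : Set Ω}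
    (hE : MeasurableSet[m] E) (h : ℝ≥0) :
    P (E ∩ {ω | X ω ≤ h}) = ENNReal.ofReal (1 - Real.exp (-(μ * h))) * P E := by
  rw [Indep_iff] at hind
  rw [hind E {ω | X ω ≤ h} hE ⟨Iic (h : ℝ), measurableSet_Iic, rfl⟩, mul_comm]
  congr 1
  rw [← expMeasure_Iic hμ h.coe_nonneg]
  exact hlaw.measure_eq measurableSet_Iic

end Independence

/-! ### Transitions of the state -/

/-- The state (flag of the server, length of the queue) belonging to a phase. -/
def queueState (z : Bool × ℕ × ℕ) : Bool × ℕ := (z.1, z.2.2)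

/-- The number of the next service to start. -/
def nextService (z : Bool × ℕ × ℕ) : ℕ := if z.1 then z.2.1 + 1 else z.2.1

/-- The state after an arrival. -/
def afterArrival (k : ℕ) : Bool × ℕ → Bool × ℕ
  | (false, n) => if n + 1 = k then (true, 0) else (false, n + 1)
  | (true, n) => (true, n + 1)

/-- The state after the completion of a service. -/
def afterCompletion (k B : ℕ) : Bool × ℕ → Bool × ℕ
  | (false, n) => (false, n)
  | (true, n) => if n < k then (false, n) else (true, n - B)

/-- If a service is going on at time `t`, it is not completed by time `u`. -/
def NoCompletion (k B : ℕ) (a : ℝ≥0 → ℕ) (s : ℕ → ℝ) (t u : ℝ≥0) : Prop :=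
  (phase k B a s t).1 = true →
    (u : ℝ≥0∞) < (completion k B a s ((phase k B a s t).2.1 + 1)).1

section Path

variable {k B : ℕ} {a a' : ℝ≥0 → ℕ} {s : ℕ → ℝ} {t u : ℝ≥0}

lemma inPhase_phase (ha : IsCountingPath a) (hk : 1 ≤ k) (hkB : k ≤ B) :
    InPhase k B a s t (phase k B a s t) :=
  (phase_eq_iff ha hk hkB).1 rfl

lemma phase_congr (ha : IsCountingPath a) (ha' : IsCountingPath a') (hk : 1 ≤ k) (hkB : k ≤ B)
    (h : ∀ v ≤ t, a v = a' v) : phase k B a s t = phase k B a' s t :=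
  ((phase_eq_iff ha' hk hkB).2 (inPhase_of_congr ha ha' h (inPhase_phase ha hk hkB)).1).symm

lemma noCompletion_congr (ha : IsCountingPath a) (ha' : IsCountingPath a') (hk : 1 ≤ k)
    (hkB : k ≤ B) (h : ∀ v ≤ t, a v = a' v) :
    NoCompletion k B a s t u ↔ NoCompletion k B a' s t u := by
  have h1 := phase_congr (s := s) ha ha' hk hkB h
  have h2 := (inPhase_of_congr ha ha' h (inPhase_phase (s := s) ha hk hkB)).2
  rw [NoCompletion, NoCompletion, ← h1]
  exact forall_congr' fun hz => by rw [h2 hz]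

lemma queueState_of_no_event (ha : IsCountingPath a) (hk : 1 ≤ k) (hkB : k ≤ B) (htu : t ≤ u)
    (hau : a u - a t = 0) (hc : NoCompletion k B a s t u) :
    queueState (phase k B a s u) = queueState (phase k B a s t) := by
  have hz := inPhase_phase (s := s) (t := t) ha hk hkB
  unfold NoCompletion at hc
  generalize phase k B a s t = z at hz hc ⊢
  obtain ⟨_ | _, j, n⟩ := z
  · have := hz.idle_of_lt ha htu (by rw [hau]; exact hz.idle_lt ha)
    rw [(phase_eq_iff ha hk hkB).2 this, hau]
    rfl
  · have := hz.busy_of_lt_completion ha htu (hc rfl)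
    rw [(phase_eq_iff ha hk hkB).2 this, hau]
    rfl

/-- The bound on the next service time matters when the arrival starts a service: that service must
not be over by time `u`. -/
lemma queueState_of_arrival (ha : IsCountingPath a) (hk : 1 ≤ k) (hkB : k ≤ B) (htu : t ≤ u)
    (hau : a u - a t = 1) (hc : NoCompletion k B a s t u)
    (hs : (u : ℝ) - t < s (nextService (phase k B a s t))) :
    queueState (phase k B a s u) = afterArrival k (queueState (phase k B a s t)) := by
  have hz := inPhase_phase (s := s) (t := t) ha hk hkB
  unfold NoCompletion at hc
  generalize phase k B a s t = z at hz hc hs ⊢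
  obtain ⟨_ | _, j, n⟩ := z
  · by_cases hn : n + 1 = k
    · have := hz.busy_of_arrival ha hkB htu hn hau hs
      rw [(phase_eq_iff ha hk hkB).2 this]
      simp [queueState, afterArrival, hn]
    · have := hz.idle_of_lt ha htu (by have := hz.idle_lt ha; omega)
      rw [(phase_eq_iff ha hk hkB).2 this, hau]
      simp [queueState, afterArrival, hn]
  · have := hz.busy_of_lt_completion ha htu (hc rfl)
    rw [(phase_eq_iff ha hk hkB).2 this, hau]
    rfl

/-- A failure of `NoCompletion` forces the server to be busy at `t`; the bound on the next service
time again allows no second completion. -/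
lemma queueState_of_completion (ha : IsCountingPath a) (hk : 1 ≤ k) (hkB : k ≤ B) (htu : t ≤ u)
    (hau : a u - a t = 0) (hc : ¬ NoCompletion k B a s t u)
    (hs : (u : ℝ) - t < s (nextService (phase k B a s t))) :
    queueState (phase k B a s u) = afterCompletion k B (queueState (phase k B a s t)) := by
  have hz := inPhase_phase (s := s) (t := t) ha hk hkB
  have hmono := ha.mono htu
  unfold NoCompletion at hc
  generalize phase k B a s t = z at hz hc hs ⊢
  obtain ⟨_ | _, j, n⟩ := z
  · simp at hc
  · have := hz.after_completion ha (by simpa using hc) (by omega) hs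
    rw [(phase_eq_iff ha hk hkB).2 this]
    simp only [queueState, afterCompletion]
    split_ifs <;> rfl

end Path

section Measurability

variable {Ω : Type*} {m : MeasurableSpace Ω} {k B : ℕ} {A : ℝ≥0 → Ω → ℕ} {s : ℕ → Ω → ℝ}

lemma measurable_random_index {β : Type*} [MeasurableSpace β] {f : ℕ → Ω → β}
    (hf : ∀ j, Measurable[m] (f j)) {J : Ω → ℕ} (hJ : Measurable[m] J) :
    Measurable[m] fun ω => f (J ω) ω := by
  have h : Measurable fun p : Ω × ℕ => f p.2 p.1 := measurable_from_prod_countable_left hf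
  exact h.comp (measurable_id.prodMk hJ)

lemma measurableSet_noCompletion (hk : 1 ≤ k) (hkB : k ≤ B) (hA : ∀ t, Measurable[m] (A t))
    (hpath : ∀ ω, IsCountingPath fun t => A t ω) (hs : ∀ i, Measurable[m] (s i)) (t u : ℝ≥0) :
    MeasurableSet[m] {ω | NoCompletion k B (fun t => A t ω) (fun i => s i ω) t u} := by
  have hph := measurable_phase hk hkB hA hpath hs t
  have hc := measurable_random_index (f := fun j ω =>
      (completion k B (fun t => A t ω) (fun i => s i ω) (j + 1)).1)
    (fun j => (measurable_completion (j := j + 1) hA hpath fun i _ => hs i).fst) hph.snd.fst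
  have : {ω | NoCompletion k B (fun t => A t ω) (fun i => s i ω) t u} =
      ((fun ω => phase k B (fun t => A t ω) (fun i => s i ω) t) ⁻¹' {z | z.1 = true})ᶜ ∪
      {ω | (u : ℝ≥0∞) < (completion k B (fun t => A t ω) (fun i => s i ω)
        ((phase k B (fun t => A t ω) (fun i => s i ω) t).2.1 + 1)).1} := by
    ext ω
    exact imp_iff_not_or
  rw [this]
  exact (hph (MeasurableSet.of_discrete)).compl.union (measurableSet_lt measurable_const hc)

end Measurability

/-- The weight of `m` in the Poisson distribution with parameter `r`. -/
noncomputable def poissonWeight (r : ℝ) (m : ℕ) : ℝ := Real.exp (-r) * r ^ m / m.factorial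

lemma poissonWeight_nonneg {r : ℝ} (hr : 0 ≤ r) (m : ℕ) : 0 ≤ poissonWeight r m := by
  unfold poissonWeight
  positivity

/-- The arrival process `N` and the service times `S` of the queue; `L` is the cumulated intensity
of the arrivals and `μ` the service rate. -/
structure IsQueueModel {Ω : Type*} [MeasurableSpace Ω] (P : Measure Ω) (L : ℝ → ℝ) (μ : ℝ)
    (N : ℝ≥0 → Ω → ℕ) (S : ℕ → Ω → ℝ) : Prop where
  measurable_arrivals : ∀ t, Measurable (N t)
  zero : ∀ ω, N 0 ω = 0
  path : ∀ ω, IsCountingPath fun t => N t ω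
  indep_increments : HasIndepIncrements N P
  monotone_intensity : ∀ ⦃t u : ℝ≥0⦄, t ≤ u → L t ≤ L u
  law_increment : ∀ ⦃t u : ℝ≥0⦄, t ≤ u → ∀ m : ℕ,
    P {ω | N u ω - N t ω = m} = ENNReal.ofReal (poissonWeight (L u - L t) m)
  rate_pos : 0 < μ
  measurable_service : ∀ j, Measurable (S j)
  law_service : ∀ j, HasLaw (S j) (expMeasure μ) P
  iIndepFun_service : iIndepFun S P
  indep_arrivals_service : IndepFun (fun ω t => N t ω) (fun ω j => S j ω) P

/-! ### Independence and memorylessness in the queue model -/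

section Model

variable {Ω : Type*} [mΩ : MeasurableSpace Ω] {P : Measure Ω}
  {L : ℝ → ℝ} {μ : ℝ} {N : ℝ≥0 → Ω → ℕ} {S : ℕ → Ω → ℝ} {k B : ℕ} {t u : ℝ≥0}

/-- The σ-algebra generated by the arrivals and the first `j` service times. -/
@[reducible] def arrivalsAndServices (N : ℝ≥0 → Ω → ℕ) (S : ℕ → Ω → ℝ) (j : ℕ) :
    MeasurableSpace Ω :=
  MeasurableSpace.comap (fun ω t => N t ω) inferInstance ⊔
    ⨆ i ∈ Iio j, MeasurableSpace.comap (S i) inferInstance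

/-- The σ-algebra generated by the arrivals up to time `t` and all service times. -/
@[reducible] def servicesAndHistory (N : ℝ≥0 → Ω → ℕ) (S : ℕ → Ω → ℝ) (t : ℝ≥0) :
    MeasurableSpace Ω :=
  MeasurableSpace.comap (fun ω j => S j ω) inferInstance ⊔ history N t

omit mΩ in
lemma measurable_arrivals_arrivalsAndServices (N : ℝ≥0 → Ω → ℕ) (S : ℕ → Ω → ℝ) (j : ℕ)
    (t : ℝ≥0) : Measurable[arrivalsAndServices N S j] (N t) := by
  have h1 : Measurable[MeasurableSpace.comap (fun ω t => N t ω) inferInstance]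
    fun ω t => N t ω := comap_measurable _
  have h2 := (measurable_pi_apply t).comp h1
  exact h2.mono le_sup_left le_rfl

omit mΩ in
lemma measurable_service_arrivalsAndServices (N : ℝ≥0 → Ω → ℕ) (S : ℕ → Ω → ℝ) {i j : ℕ}
    (hij : i < j) : Measurable[arrivalsAndServices N S j] (S i) := by
  refine (comap_measurable (S i)).mono (le_trans ?_ le_sup_right) le_rfl
  exact le_iSup₂ (f := fun (i : ℕ) (_ : i ∈ Iio j) =>
    MeasurableSpace.comap (S i) inferInstance) i hij

omit mΩ in
lemma measurable_stopped_servicesAndHistory (N : ℝ≥0 → Ω → ℕ) (S : ℕ → Ω → ℝ) (t v : ℝ≥0) :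
    Measurable[servicesAndHistory N S t] (N (min v t)) :=
  (comap_measurable (N (min v t))).mono (le_trans (le_iSup (fun v : ℝ≥0 =>
    MeasurableSpace.comap (N (min v t)) inferInstance) v) le_sup_right) le_rfl

omit mΩ in
lemma measurable_service_servicesAndHistory (N : ℝ≥0 → Ω → ℕ) (S : ℕ → Ω → ℝ) (t : ℝ≥0)
    (j : ℕ) : Measurable[servicesAndHistory N S t] (S j) := by
  have h1 : Measurable[MeasurableSpace.comap (fun ω j => S j ω) inferInstance]
    fun ω j => S j ω := comap_measurable _
  have h2 := (measurable_pi_apply j).comp h1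
  exact h2.mono le_sup_left le_rfl

namespace IsQueueModel

variable (hM : IsQueueModel P L μ N S)
include hM

lemma arrivalsAndServices_le (j : ℕ) : arrivalsAndServices N S j ≤ mΩ :=
  sup_le (measurable_pi_lambda _ hM.measurable_arrivals).comap_le
    (iSup₂_le fun i _ => (hM.measurable_service i).comap_le)

lemma history_le (t : ℝ≥0) : history N t ≤ mΩ :=
  iSup_le fun _ => (hM.measurable_arrivals _).comap_le

lemma servicesAndHistory_le (t : ℝ≥0) : servicesAndHistory N S t ≤ mΩ :=
  sup_le (measurable_pi_lambda _ hM.measurable_service).comap_le (hM.history_le t)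

section

variable (hk : 1 ≤ k) (hkB : k ≤ B)
include hk hkB

lemma measurableSet_phase_servicesAndHistory (t : ℝ≥0) (Q : Set (Bool × ℕ × ℕ)) :
    MeasurableSet[servicesAndHistory N S t]
      {ω | phase k B (fun v => N v ω) (fun i => S i ω) t ∈ Q} := by
  have h := measurable_phase (A := fun v => N (min v t)) hk hkB
    (measurable_stopped_servicesAndHistory N S t) (fun ω => (hM.path ω).stopped t)
    (measurable_service_servicesAndHistory N S t) t
  convert h (MeasurableSet.of_discrete (s := Q)) using 1
  ext ω
  rw [mem_preimage, ← phase_congr (hM.path ω) ((hM.path ω).stopped t) hk hkB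
    (fun v hv => by rw [min_eq_left hv])]
  rfl

lemma measurableSet_noCompletion_servicesAndHistory (t u : ℝ≥0) :
    MeasurableSet[servicesAndHistory N S t]
      {ω | NoCompletion k B (fun v => N v ω) (fun i => S i ω) t u} := by
  have h := measurableSet_noCompletion (A := fun v => N (min v t)) hk hkB
    (measurable_stopped_servicesAndHistory N S t) (fun ω => (hM.path ω).stopped t)
    (measurable_service_servicesAndHistory N S t) t u
  convert h using 1
  ext ω
  exact noCompletion_congr (hM.path ω) ((hM.path ω).stopped t) hk hkB
    (fun v hv => by rw [min_eq_left hv])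

lemma measurableSet_phase (t : ℝ≥0) (Q : Set (Bool × ℕ × ℕ)) :
    MeasurableSet {ω | phase k B (fun v => N v ω) (fun i => S i ω) t ∈ Q} :=
  hM.servicesAndHistory_le t _ (hM.measurableSet_phase_servicesAndHistory hk hkB t Q)

lemma measurableSet_noCompletion (t u : ℝ≥0) :
    MeasurableSet {ω | NoCompletion k B (fun v => N v ω) (fun i => S i ω) t u} :=
  hM.servicesAndHistory_le t _ (hM.measurableSet_noCompletion_servicesAndHistory hk hkB t u)

end

variable [IsProbabilityMeasure P]

lemma indep_service (j : ℕ) :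
    Indep (arrivalsAndServices N S j) (MeasurableSpace.comap (S j) inferInstance) P := by
  have hle : ∀ i, MeasurableSpace.comap (S i) inferInstance ≤
      MeasurableSpace.comap (fun ω j => S j ω) inferInstance := by
    intro i
    have h1 : Measurable[MeasurableSpace.comap (fun ω j => S j ω) inferInstance]
      fun ω j => S j ω := comap_measurable _
    exact ((measurable_pi_apply i).comp h1).comap_le
  refine indep_sup_left_of_indep (measurable_pi_lambda _ hM.measurable_arrivals).comap_le
    (iSup₂_le fun i _ => (hM.measurable_service i).comap_le) (hM.measurable_service j).comap_le
    ?_ ?_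
  · have := hM.indep_arrivals_service
    rw [IndepFun_iff_Indep] at this
    exact indep_of_indep_of_le_right this (sup_le (iSup₂_le fun i _ => hle i) (hle j))
  · have := hM.iIndepFun_service
    rw [iIndepFun_iff_iIndep] at this
    have h2 := indep_iSup_of_disjoint (fun i => (hM.measurable_service i).comap_le) this
      (S := Iio j) (T := {j}) (by simp)
    simpa using h2

/-- All service times, including future ones, may be counted as past, since they are independent of
the arrivals. So the phase at `t` and the absence of a completion by `u` are, jointly, independent
of the number of arrivals in `(t, u]`. -/
lemma indep_increment (htu : t ≤ u) : Indep (servicesAndHistory N S t)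
    (MeasurableSpace.comap (fun ω => N u ω - N t ω) inferInstance) P := by
  have hinc : Measurable fun ω => N u ω - N t ω :=
    (hM.measurable_arrivals u).sub (hM.measurable_arrivals t)
  refine indep_sup_left_of_indep (measurable_pi_lambda _ hM.measurable_service).comap_le
    (hM.history_le t) hinc.comap_le ?_ ?_
  · have := hM.indep_arrivals_service.symm
    rw [IndepFun_iff_Indep] at this
    have h1 : Measurable[MeasurableSpace.comap (fun ω t => N t ω) inferInstance]
      fun ω t => N t ω := comap_measurable _
    have h2 := fun v => (measurable_pi_apply v).comp h1
    refine indep_of_indep_of_le_right this (sup_le (iSup_le fun v => (h2 _).comap_le) ?_)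
    exact ((h2 u).sub (h2 t)).comap_le
  · exact indep_history hM.measurable_arrivals hM.zero (fun ω => (hM.path ω).mono)
      hM.indep_increments htu

lemma real_inter_increment (htu : t ≤ u) {E : Set Ω}
    (hE : MeasurableSet[servicesAndHistory N S t] E) (m : ℕ) :
    P.real (E ∩ {ω | N u ω - N t ω = m}) = P.real E * poissonWeight (L u - L t) m := by
  have := hM.indep_increment htu
  rw [Indep_iff] at this
  rw [Measure.real, this E {ω | N u ω - N t ω = m} hE ⟨{m}, trivial, rfl⟩, ENNReal.toReal_mul,
    hM.law_increment htu, ENNReal.toReal_ofReal (poissonWeight_nonneg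
      (sub_nonneg.2 (hM.monotone_intensity htu)) m), Measure.real]

variable (hk : 1 ≤ k) (hkB : k ≤ B)
include hk hkB

/-- Memorylessness for a fixed service `j`: the event of being in it at `t` is `E ∩ {T < S j}`,
where `E` and the elapsed time `T` depend only on the arrivals and earlier services, and survival
until `u` means `T + (u - t) < S j`. -/
lemma measure_busy_inter_noCompletion (htu : t ≤ u) {Q : Set (Bool × ℕ × ℕ)}
    (hQ : ∀ z ∈ Q, z.1 = true) :
    P ({ω | phase k B (fun v => N v ω) (fun i => S i ω) t ∈ Q} ∩
        {ω | NoCompletion k B (fun v => N v ω) (fun i => S i ω) t u}) =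
      ENNReal.ofReal (Real.exp (-(μ * (u - t)))) *
        P {ω | phase k B (fun v => N v ω) (fun i => S i ω) t ∈ Q} := by
  have key := measure_preimage_inter_eq_mul (P := P) (W := univ) (Q := Q)
    (Z := fun ω => phase k B (fun v => N v ω) (fun i => S i ω) t)
    (V := {ω | NoCompletion k B (fun v => N v ω) (fun i => S i ω) t u})
    (c := ENNReal.ofReal (Real.exp (-(μ * (u - t)))))
    (fun z => hM.measurableSet_phase hk hkB t {z}) ?_
  · rwa [inter_univ] at key
  intro z hz
  obtain ⟨b, j, n⟩ := z
  obtain rfl : b = true := hQ _ hz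
  have hc := measurable_completion (k := k) (B := B) (j := j)
    (measurable_arrivals_arrivalsAndServices N S j) hM.path
    (fun i hi => measurable_service_arrivalsAndServices N S hi)
  have hσ := measurable_serviceStart_of_completion
    (measurable_arrivals_arrivalsAndServices N S j) hM.path hc
  have hd := measurable_completion_succ_snd
    (measurable_arrivals_arrivalsAndServices N S j) hM.path hc
  set E : Set Ω := {ω | serviceStart k B (fun v => N v ω) (fun i => S i ω) j ≤ t} ∩
    {ω | (completion k B (fun v => N v ω) (fun i => S i ω) (j + 1)).2 + n = N t ω}
  have hE : MeasurableSet[arrivalsAndServices N S j] E :=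
    (measurableSet_le hσ measurable_const).inter
      (measurableSet_eq_fun (hd.add_const n) (measurable_arrivals_arrivalsAndServices N S j t))
  set T : Ω → ℝ≥0 := fun ω =>
    (t - serviceStart k B (fun v => N v ω) (fun i => S i ω) j : ℝ≥0∞).toNNReal
  have hT : Measurable[arrivalsAndServices N S j] T :=
    (measurable_const.sub hσ).ennreal_toNNReal
  have hres : ∀ ω ∈ E, ∀ h : ℝ≥0,
      ((t + h : ℝ≥0) : ℝ≥0∞) < (completion k B (fun v => N v ω) (fun i => S i ω) (j + 1)).1 ↔
        (T ω : ℝ) + h < S j ω := by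
    intro ω hω h
    obtain ⟨v, hv⟩ := exists_coe_eq_of_le_coe hω.1
    have hvt : v ≤ t := by
      have := hω.1
      rw [mem_ofPred_eq, ← hv] at this
      exact_mod_cast this
    have hTω : (T ω : ℝ) = t - v := by
      simp only [T, ← hv]
      rw [← ENNReal.coe_sub, ENNReal.toNNReal_coe, NNReal.coe_sub hvt]
    rw [completion_succ_fst, ← hv, ENNReal.ofReal, ← ENNReal.coe_add, ENNReal.coe_lt_coe, hTω,
      ← NNReal.coe_lt_coe, NNReal.coe_add, NNReal.coe_add, Real.coe_toNNReal']
    have h1 : (v : ℝ) ≤ t := hvt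
    have h2 := h.coe_nonneg
    -- A negative service time counts as `0`. Then both inequalities fail, because `T` and `h` are
    -- nonnegative.
    rcases le_total (S j ω) 0 with h3 | h3
    · rw [max_eq_right h3]
      constructor <;> intro h4 <;> linarith
    · rw [max_eq_left h3]
      constructor <;> intro h4 <;> linarith
  have e1 : (fun ω => phase k B (fun v => N v ω) (fun i => S i ω) t) ⁻¹' {(true, j, n)} ∩ univ =
      E ∩ {ω | (T ω : ℝ) < S j ω} := by
    ext ω
    have h0 := fun hω => hres ω hω 0
    simp only [add_zero, NNReal.coe_zero] at h0
    simp only [inter_univ, mem_preimage, mem_singleton_iff, phase_eq_iff (hM.path ω) hk hkB]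
    constructor
    · intro h
      have hω : ω ∈ E := ⟨h.1, h.2.2⟩
      exact ⟨hω, (h0 hω).1 h.2.1⟩
    · intro h
      exact ⟨h.1.1, (h0 h.1).2 h.2, h.1.2⟩
  have e2 : (fun ω => phase k B (fun v => N v ω) (fun i => S i ω) t) ⁻¹' {(true, j, n)} ∩
      {ω | NoCompletion k B (fun v => N v ω) (fun i => S i ω) t u} =
      E ∩ {ω | (T ω : ℝ) + (u - t : ℝ≥0) < S j ω} := by
    ext ω
    have h0 := fun hω => hres ω hω (u - t)
    rw [add_tsub_cancel_of_le htu] at h0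
    constructor
    · rintro ⟨h, h'⟩
      have h2 := (phase_eq_iff (hM.path ω) hk hkB).1 h
      have hω : ω ∈ E := ⟨h2.1, h2.2.2⟩
      rw [mem_preimage, mem_singleton_iff] at h
      rw [mem_ofPred_eq, NoCompletion, h] at h'
      exact ⟨hω, (h0 hω).1 (h' rfl)⟩
    · intro h
      have h1 := (h0 h.1).2 h.2
      have h2 : phase k B (fun v => N v ω) (fun i => S i ω) t = (true, j, n) := by
        rw [phase_eq_iff (hM.path ω) hk hkB]
        exact ⟨h.1.1, lt_of_le_of_lt (by exact_mod_cast htu) h1, h.1.2⟩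
      refine ⟨h2, ?_⟩
      rw [mem_ofPred_eq, NoCompletion, h2]
      exact fun _ => h1
  rw [e1, e2, measure_inter_lt_exp_of_indep hM.rate_pos (hM.measurable_service j)
    (hM.law_service j) (hM.arrivalsAndServices_le j) (hM.indep_service j) hE hT,
    NNReal.coe_sub htu]

lemma real_inter_noCompletion (htu : t ≤ u) (Q : Set (Bool × ℕ × ℕ)) :
    P.real ({ω | phase k B (fun v => N v ω) (fun i => S i ω) t ∈ Q} ∩
        {ω | NoCompletion k B (fun v => N v ω) (fun i => S i ω) t u}) =
      P.real {ω | phase k B (fun v => N v ω) (fun i => S i ω) t ∈ Q ∩ {z | z.1 = false}} +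
      Real.exp (-(μ * (u - t))) *
        P.real {ω | phase k B (fun v => N v ω) (fun i => S i ω) t ∈ Q ∩ {z | z.1 = true}} := by
  have h1 := hM.measure_busy_inter_noCompletion hk hkB htu (Q := Q ∩ {z | z.1 = true})
    fun z hz => hz.2
  have h2 : Real.exp (-(μ * (u - t))) *
      P.real {ω | phase k B (fun v => N v ω) (fun i => S i ω) t ∈ Q ∩ {z | z.1 = true}} =
      P.real ({ω | phase k B (fun v => N v ω) (fun i => S i ω) t ∈ Q ∩ {z | z.1 = true}} ∩
        {ω | NoCompletion k B (fun v => N v ω) (fun i => S i ω) t u}) := by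
    rw [Measure.real, Measure.real, h1, ENNReal.toReal_mul,
      ENNReal.toReal_ofReal (Real.exp_pos _).le]
  rw [h2, ← measureReal_union _ ((hM.measurableSet_phase hk hkB t _).inter
    (hM.measurableSet_noCompletion hk hkB t u))]
  · congr 1
    ext ω
    simp only [mem_inter_iff, mem_union, mem_ofPred_eq]
    cases hb : (phase k B (fun v => N v ω) (fun i => S i ω) t).1 <;> simp [NoCompletion, hb]
  · rw [disjoint_left]
    rintro ω ⟨_, h3⟩ ⟨⟨_, h4⟩, _⟩
    simp only [mem_ofPred_eq] at h3 h4
    simp [h3] at h4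

/-- Whether something happens in `(t, u]` is independent of the next service time. -/
lemma measure_event_inter_nextService_le (t u : ℝ≥0) (h : ℝ≥0) :
    P ({ω | 1 ≤ N u ω - N t ω ∨ ¬ NoCompletion k B (fun v => N v ω) (fun i => S i ω) t u} ∩
        {ω | S (nextService (phase k B (fun v => N v ω) (fun i => S i ω) t)) ω ≤ h}) =
      ENNReal.ofReal (1 - Real.exp (-(μ * h))) *
        P {ω | 1 ≤ N u ω - N t ω ∨
          ¬ NoCompletion k B (fun v => N v ω) (fun i => S i ω) t u} := by
  set V : Set Ω :=
    {ω | 1 ≤ N u ω - N t ω ∨ ¬ NoCompletion k B (fun v => N v ω) (fun i => S i ω) t u}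
  set Z := fun ω => phase k B (fun v => N v ω) (fun i => S i ω) t with hZ
  have key := measure_preimage_inter_eq_mul (P := P) (W := V) (Q := univ) (Z := Z)
    (V := V ∩ {ω | S (nextService (phase k B (fun v => N v ω) (fun i => S i ω) t)) ω ≤ h})
    (c := ENNReal.ofReal (1 - Real.exp (-(μ * h))))
    (fun z => hM.measurableSet_phase hk hkB t {z}) ?_
  · simpa using key
  -- Once the phase is fixed, the number of the next service is deterministic, and the event
  -- involves only the arrivals and the services with smaller numbers.
  rintro z -
  have hA := measurable_arrivals_arrivalsAndServices N S (nextService z)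
  have hs : ∀ i < nextService z, Measurable[arrivalsAndServices N S (nextService z)] (S i) :=
    fun i hi => measurable_service_arrivalsAndServices N S hi
  have harr : MeasurableSet[arrivalsAndServices N S (nextService z)]
      {ω | 1 ≤ N u ω - N t ω} :=
    measurableSet_le measurable_const ((hA u).sub (hA t))
  have hset : MeasurableSet[arrivalsAndServices N S (nextService z)] (Z ⁻¹' {z} ∩ V) := by
    have hpre : Z ⁻¹' {z} =
        {ω | InPhase k B (fun v => N v ω) (fun i => S i ω) t z} := by
      ext ω
      exact phase_eq_iff (hM.path ω) hk hkB
    obtain ⟨_ | _, j, n⟩ := z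
    · have : Z ⁻¹' {(false, j, n)} ∩ V = Z ⁻¹' {(false, j, n)} ∩ {ω | 1 ≤ N u ω - N t ω} := by
        ext ω
        refine and_congr_right fun hω => ?_
        have hω' : phase k B (fun v => N v ω) (fun i => S i ω) t = (false, j, n) := hω
        simp [V, NoCompletion, hω']
      rw [this, hpre]
      exact (measurableSet_inPhase_idle hA hM.path hs t n).inter harr
    · have : Z ⁻¹' {(true, j, n)} ∩ V = Z ⁻¹' {(true, j, n)} ∩ ({ω | 1 ≤ N u ω - N t ω} ∪
          {ω | (completion k B (fun v => N v ω) (fun i => S i ω) (j + 1)).1 ≤ u}) := by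
        ext ω
        refine and_congr_right fun hω => ?_
        have hω' : phase k B (fun v => N v ω) (fun i => S i ω) t = (true, j, n) := hω
        simp [V, NoCompletion, hω']
      rw [this, hpre]
      exact (measurableSet_inPhase hA hM.path _ hs t).inter
        (harr.union (measurableSet_le (measurable_completion hA hM.path hs).fst measurable_const))
  rw [← measure_inter_exp_le_of_indep hM.rate_pos (hM.law_service (nextService z))
    (hM.indep_service (nextService z)) hset, inter_assoc]
  congr 1
  ext ω
  simp only [mem_inter_iff, mem_preimage, mem_singleton_iff, mem_ofPred_eq]
  refine and_congr_right fun hω => and_congr_right fun _ => ?_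
  rw [← hω]

end IsQueueModel

end Model

/-- The probability that the state at time `t` belongs to `F`. -/
noncomputable def stateProb {Ω : Type*} [MeasurableSpace Ω] (P : Measure Ω) (k B : ℕ)
    (N : ℝ≥0 → Ω → ℕ) (S : ℕ → Ω → ℝ) (F : Set (Bool × ℕ)) (t : ℝ) : ℝ :=
  P.real {ω | queueState (phase k B (fun v => N v ω) (fun i => S i ω) t.toNNReal) ∈ F}

/-- The idle states. -/
def idleStates : Set (Bool × ℕ) := {z | z.1 = false}

/-- The busy states. -/
def busyStates : Set (Bool × ℕ) := {z | z.1 = true}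

lemma idleStates_union_busyStates (F : Set (Bool × ℕ)) :
    F ∩ idleStates ∪ F ∩ busyStates = F := by
  ext ⟨_ | _, n⟩ <;> simp [idleStates, busyStates]

lemma disjoint_inter_idleStates_busyStates (F F' : Set (Bool × ℕ)) :
    Disjoint (F ∩ idleStates) (F' ∩ busyStates) := by
  rw [disjoint_left]
  rintro ⟨_ | _, n⟩ <;> simp [idleStates, busyStates]

lemma one_sub_exp_neg_le (a : ℝ) : 1 - Real.exp (-a) ≤ a := by
  have := Real.add_one_le_exp (-a)
  linarith

/-! ### Short-time expansion of the state probabilities -/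

namespace IsQueueModel

variable {Ω : Type*} [mΩ : MeasurableSpace Ω] {P : Measure Ω} [IsProbabilityMeasure P]
  {L : ℝ → ℝ} {μ : ℝ} {N : ℝ≥0 → Ω → ℕ} {S : ℕ → Ω → ℝ} {k B : ℕ} {t u : ℝ≥0}
  (hM : IsQueueModel P L μ N S)
include hM

omit [IsProbabilityMeasure P] in
lemma measurable_increment (t u : ℝ≥0) : Measurable fun ω => N u ω - N t ω :=
  (hM.measurable_arrivals u).sub (hM.measurable_arrivals t)

lemma real_increment (htu : t ≤ u) (m : ℕ) :
    P.real {ω | N u ω - N t ω = m} = poissonWeight (L u - L t) m := by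
  simpa using hM.real_inter_increment htu (E := univ) MeasurableSet.univ m

lemma real_inter_one_le_increment (htu : t ≤ u) {E : Set Ω}
    (hE : MeasurableSet[servicesAndHistory N S t] E) :
    P.real (E ∩ {ω | 1 ≤ N u ω - N t ω}) = P.real E * (1 - Real.exp (-(L u - L t))) := by
  have h0 := hM.real_inter_increment htu hE 0
  have hm := hM.measurable_increment t u (measurableSet_singleton 0)
  have h1 := measureReal_inter_add_sdiff (μ := P) (s := E) hm
  have : E \ ((fun ω => N u ω - N t ω) ⁻¹' {0}) = E ∩ {ω | 1 ≤ N u ω - N t ω} := by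
    ext ω
    simp only [mem_sdiff, mem_preimage, mem_singleton_iff, mem_inter_iff, mem_ofPred_eq]
    exact and_congr_right fun _ => by omega
  rw [this] at h1
  have h2 : E ∩ ((fun ω => N u ω - N t ω) ⁻¹' {0}) = E ∩ {ω | N u ω - N t ω = 0} := rfl
  rw [h2, h0] at h1
  simp only [poissonWeight, pow_zero, mul_one, Nat.factorial_zero, Nat.cast_one, div_one] at h1
  linarith

lemma real_two_le_increment_le (htu : t ≤ u) :
    P.real {ω | 2 ≤ N u ω - N t ω} ≤ (L u - L t) ^ 2 := by
  have h0 := hM.real_inter_one_le_increment htu (E := univ) MeasurableSet.univ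
  have h1 := hM.real_increment htu 1
  have ha := sub_nonneg.2 (hM.monotone_intensity htu)
  have hunion : univ ∩ {ω | 1 ≤ N u ω - N t ω} =
      {ω | N u ω - N t ω = 1} ∪ {ω | 2 ≤ N u ω - N t ω} := by
    ext ω
    simp only [univ_inter, mem_ofPred_eq, mem_union]
    omega
  rw [hunion, measureReal_union _ (measurableSet_le measurable_const
    (hM.measurable_increment t u)), h1] at h0
  · simp only [poissonWeight, pow_one, Nat.factorial_one, Nat.cast_one, div_one, probReal_univ,
      one_mul] at h0
    have h2 := one_sub_exp_neg_le (L u - L t)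
    -- With `a = L u - L t`: `1 - exp (-a) - a * exp (-a) ≤ a * (1 - exp (-a)) ≤ a ^ 2`.
    nlinarith
  · rw [disjoint_left]
    intro ω h3 h4
    simp only [mem_ofPred_eq] at h3 h4
    omega

variable (hk : 1 ≤ k) (hkB : k ≤ B)
include hk hkB

omit [IsProbabilityMeasure P] in
lemma measurableSet_state (t : ℝ≥0) (F : Set (Bool × ℕ)) :
    MeasurableSet {ω | queueState (phase k B (fun v => N v ω) (fun i => S i ω) t) ∈ F} :=
  hM.measurableSet_phase hk hkB t (queueState ⁻¹' F)

lemma stateProb_union {F F' : Set (Bool × ℕ)} (hF : Disjoint F F') (t : ℝ) :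
    stateProb P k B N S (F ∪ F') t = stateProb P k B N S F t + stateProb P k B N S F' t :=
  measureReal_union (disjoint_left.2 fun _ h h' => disjoint_left.1 hF h h')
    (hM.measurableSet_state hk hkB _ F')

lemma stateProb_idle_add_busy (F : Set (Bool × ℕ)) (t : ℝ) :
    stateProb P k B N S (F ∩ idleStates) t + stateProb P k B N S (F ∩ busyStates) t =
      stateProb P k B N S F t := by
  rw [← hM.stateProb_union hk hkB (disjoint_inter_idleStates_busyStates F F),
    idleStates_union_busyStates]

lemma real_state_inter_noCompletion (htu : t ≤ u) (F : Set (Bool × ℕ)) :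
    P.real ({ω | queueState (phase k B (fun v => N v ω) (fun i => S i ω) t) ∈ F} ∩
        {ω | NoCompletion k B (fun v => N v ω) (fun i => S i ω) t u}) =
      stateProb P k B N S (F ∩ idleStates) t +
      Real.exp (-(μ * (u - t))) * stateProb P k B N S (F ∩ busyStates) t := by
  have := hM.real_inter_noCompletion hk hkB htu (queueState ⁻¹' F)
  simp only [stateProb, Real.toNNReal_coe]
  exact this

lemma real_state_inter_completion (htu : t ≤ u) (F : Set (Bool × ℕ)) :
    P.real ({ω | queueState (phase k B (fun v => N v ω) (fun i => S i ω) t) ∈ F} ∩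
        {ω | ¬ NoCompletion k B (fun v => N v ω) (fun i => S i ω) t u}) =
      (1 - Real.exp (-(μ * (u - t)))) * stateProb P k B N S (F ∩ busyStates) t := by
  have h1 := hM.real_state_inter_noCompletion hk hkB htu F
  have h2 := measureReal_inter_add_sdiff (μ := P)
    (s := {ω | queueState (phase k B (fun v => N v ω) (fun i => S i ω) t) ∈ F})
    (hM.measurableSet_noCompletion hk hkB t u)
  have h3 := hM.stateProb_idle_add_busy hk hkB F t
  have h4 : stateProb P k B N S F t =
      P.real {ω | queueState (phase k B (fun v => N v ω) (fun i => S i ω) t) ∈ F} := by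
    rw [stateProb, Real.toNNReal_coe]
  rw [h1, sdiff_eq, ← h4, compl_ofPred] at h2
  linarith

lemma real_completion_le (htu : t ≤ u) :
    P.real {ω | ¬ NoCompletion k B (fun v => N v ω) (fun i => S i ω) t u} ≤ μ * (u - t) := by
  have h1 := hM.real_state_inter_completion hk hkB htu univ
  have h2 : {ω | queueState (phase k B (fun v => N v ω) (fun i => S i ω) t) ∈ univ} = univ := by
    simp
  rw [h2, univ_inter] at h1
  rw [h1]
  have h3 : stateProb P k B N S (univ ∩ busyStates) t ≤ 1 := measureReal_le_one
  have h4 : 0 ≤ stateProb P k B N S (univ ∩ busyStates) t := measureReal_nonneg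
  have h5 := one_sub_exp_neg_le (μ * (u - t))
  have h6 : 0 ≤ μ * ((u : ℝ) - t) := mul_nonneg hM.rate_pos.le (sub_nonneg.2 htu)
  nlinarith

lemma real_event_le (htu : t ≤ u) :
    P.real {ω | 1 ≤ N u ω - N t ω ∨
      ¬ NoCompletion k B (fun v => N v ω) (fun i => S i ω) t u} ≤ L u - L t + μ * (u - t) := by
  have h1 := hM.real_inter_one_le_increment htu (E := univ) MeasurableSet.univ
  rw [univ_inter, probReal_univ, one_mul] at h1
  refine (measureReal_union_le {ω | 1 ≤ N u ω - N t ω} _).trans (add_le_add ?_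
    (hM.real_completion_le hk hkB htu))
  rw [h1]
  exact one_sub_exp_neg_le _

lemma abs_stateProb_sub_le (htu : t ≤ u) (F : Set (Bool × ℕ)) :
    |stateProb P k B N S F u - stateProb P k B N S F t| ≤ L u - L t + μ * (u - t) := by
  refine le_trans ?_ (hM.real_event_le hk hkB htu)
  refine (abs_measureReal_sub_le_measureReal_symmDiff
    (hM.measurableSet_state hk hkB _ F).nullMeasurableSet
    (hM.measurableSet_state hk hkB _ F).nullMeasurableSet).trans (measureReal_mono ?_)
  intro ω hω
  by_contra hno
  simp only [mem_ofPred_eq, not_or, not_le, not_not] at hno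
  have := queueState_of_no_event (hM.path ω) hk hkB htu (by omega) hno.2
  simp only [Real.toNNReal_coe, mem_symmDiff, mem_ofPred_eq, this] at hω
  tauto

/-- First-order expansion of the state probabilities. -/
lemma abs_stateProb_sub_expansion_le (htu : t ≤ u) (F : Set (Bool × ℕ)) :
    |stateProb P k B N S F u -
      ((stateProb P k B N S (F ∩ idleStates) t +
        Real.exp (-(μ * (u - t))) * stateProb P k B N S (F ∩ busyStates) t) *
          poissonWeight (L u - L t) 0 +
      (stateProb P k B N S (afterArrival k ⁻¹' F ∩ idleStates) t +
        Real.exp (-(μ * (u - t))) * stateProb P k B N S (afterArrival k ⁻¹' F ∩ busyStates) t) *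
          poissonWeight (L u - L t) 1 +
      (1 - Real.exp (-(μ * (u - t)))) *
        stateProb P k B N S (afterCompletion k B ⁻¹' F ∩ busyStates) t *
          poissonWeight (L u - L t) 0)| ≤ (L u - L t + μ * (u - t)) ^ 2 := by
  set q : ℝ≥0 → Ω → Bool × ℕ := fun v ω =>
    queueState (phase k B (fun v => N v ω) (fun i => S i ω) v) with hq
  set C : Set Ω := {ω | NoCompletion k B (fun v => N v ω) (fun i => S i ω) t u}
  set C' : Set Ω := {ω | ¬ NoCompletion k B (fun v => N v ω) (fun i => S i ω) t u}
  have hqt : ∀ G : Set (Bool × ℕ), MeasurableSet[servicesAndHistory N S t] {ω | q t ω ∈ G} :=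
    fun G => hM.measurableSet_phase_servicesAndHistory hk hkB t (queueState ⁻¹' G)
  have hC : MeasurableSet[servicesAndHistory N S t] C :=
    hM.measurableSet_noCompletion_servicesAndHistory hk hkB t u
  have hC' : MeasurableSet[servicesAndHistory N S t] C' := hC.compl
  have hA : ∀ m, MeasurableSet {ω | N u ω - N t ω = m} := fun m =>
    hM.measurable_increment t u (measurableSet_singleton m)
  have hle := hM.servicesAndHistory_le t
  -- The three main cases: no event, one arrival without a completion, a completion without an
  -- arrival.
  set D₀ := ({ω | q t ω ∈ F} ∩ C) ∩ {ω | N u ω - N t ω = 0} with hD₀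
  set D₁ := ({ω | q t ω ∈ afterArrival k ⁻¹' F} ∩ C) ∩ {ω | N u ω - N t ω = 1} with hD₁
  set D₂ := ({ω | q t ω ∈ afterCompletion k B ⁻¹' F} ∩ C') ∩ {ω | N u ω - N t ω = 0} with hD₂
  have hm₀ : MeasurableSet D₀ := (hle _ ((hqt _).inter hC)).inter (hA 0)
  have hm₁ : MeasurableSet D₁ := (hle _ ((hqt _).inter hC)).inter (hA 1)
  have hm₂ : MeasurableSet D₂ := (hle _ ((hqt _).inter hC')).inter (hA 0)
  have hd₀₁ : Disjoint D₀ D₁ := disjoint_left.2 fun ω h h' => by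
    have h1 : N u ω - N t ω = 0 := h.2
    have h2 : N u ω - N t ω = 1 := h'.2
    omega
  have hd₂ : Disjoint (D₀ ∪ D₁) D₂ := disjoint_left.2 fun ω h h' => by
    have h2 : ω ∈ C' := h'.1.2
    rcases h with h | h
    · exact h2 h.1.2
    · exact h2 h.1.2
  have hsum : P.real (D₀ ∪ D₁ ∪ D₂) = P.real D₀ + P.real D₁ + P.real D₂ := by
    rw [measureReal_union hd₂ hm₂, measureReal_union hd₀₁ hm₁]
  have e₀ := hM.real_inter_increment htu ((hqt F).inter hC) 0
  have e₁ := hM.real_inter_increment htu ((hqt (afterArrival k ⁻¹' F)).inter hC) 1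
  have e₂ := hM.real_inter_increment htu ((hqt (afterCompletion k B ⁻¹' F)).inter hC') 0
  rw [hM.real_state_inter_noCompletion hk hkB htu] at e₀ e₁
  rw [hM.real_state_inter_completion hk hkB htu] at e₂
  rw [← e₀, ← e₁, ← e₂, ← hsum]
  set h : ℝ≥0 := u - t with hh
  have hcoe : (h : ℝ) = u - t := NNReal.coe_sub htu
  have hS := hM.measure_event_inter_nextService_le hk hkB t u h
  set V : Set Ω := {ω | 1 ≤ N u ω - N t ω ∨
      ¬ NoCompletion k B (fun v => N v ω) (fun i => S i ω) t u}
  set R : Set Ω :=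
    {ω | S (nextService (phase k B (fun v => N v ω) (fun i => S i ω) t)) ω ≤ h}
  have hstate : stateProb P k B N S F u = P.real {ω | q u ω ∈ F} := by
    rw [stateProb, Real.toNNReal_coe]
  -- Apart from two arrivals, an arrival together with a completion, or an event with a next service
  -- of length at most `u - t`, one of the three deterministic transitions applies.
  have hsub : symmDiff {ω | q u ω ∈ F} (D₀ ∪ D₁ ∪ D₂) ⊆
      ({ω | 2 ≤ N u ω - N t ω} ∪ C' ∩ {ω | 1 ≤ N u ω - N t ω}) ∪ V ∩ R := by
    intro ω hω
    by_contra hno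
    simp only [mem_union, mem_inter_iff, not_or, not_and] at hno
    obtain ⟨⟨hno₁, hno₂⟩, hno₃⟩ := hno
    have hno₁' : ¬ 2 ≤ N u ω - N t ω := hno₁
    by_cases hc : NoCompletion k B (fun v => N v ω) (fun i => S i ω) t u
    · have hc' : ω ∉ C' := fun h => h hc
      rcases Nat.eq_zero_or_pos (N u ω - N t ω) with h0 | h0
      · have := queueState_of_no_event (hM.path ω) hk hkB htu h0 hc
        have hqq : q u ω = q t ω := this
        simp [mem_symmDiff, hD₀, hD₁, hD₂, hc', h0, hqq, show ω ∈ C from hc] at hω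
      · have hR : ω ∉ R := hno₃ (Or.inl h0)
        have h1 : N u ω - N t ω = 1 := by omega
        have hR' : (u : ℝ) - t < S (nextService
          (phase k B (fun v => N v ω) (fun i => S i ω) t)) ω := by
          rw [← hcoe]
          exact not_le.1 hR
        have := queueState_of_arrival (hM.path ω) hk hkB htu h1 hc hR'
        have hqq : q u ω = afterArrival k (q t ω) := this
        simp [mem_symmDiff, hD₀, hD₁, hD₂, hc', h1, hqq, show ω ∈ C from hc] at hω
    · have hc' : ω ∈ C' := hc
      have h0 : N u ω - N t ω = 0 := by
        have h1 : ¬ 1 ≤ N u ω - N t ω := hno₂ hc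
        omega
      have hR : ω ∉ R := hno₃ (Or.inr hc)
      have hR' : (u : ℝ) - t < S (nextService
          (phase k B (fun v => N v ω) (fun i => S i ω) t)) ω := by
        rw [← hcoe]
        exact not_le.1 hR
      have := queueState_of_completion (hM.path ω) hk hkB htu h0 hc hR'
      have hqq : q u ω = afterCompletion k B (q t ω) := this
      simp [mem_symmDiff, hD₀, hD₁, hD₂, hc', h0, hqq, show ω ∉ C from hc] at hω
  rw [hstate]
  refine (abs_measureReal_sub_le_measureReal_symmDiff
    (hM.measurableSet_state hk hkB _ F).nullMeasurableSet
    ((hm₀.union hm₁).union hm₂).nullMeasurableSet).trans ?_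
  refine (measureReal_mono hsub).trans ?_
  refine (measureReal_union_le _ _).trans ?_
  have b₁ := measureReal_union_le (μ := P) {ω | 2 ≤ N u ω - N t ω}
    (C' ∩ {ω | 1 ≤ N u ω - N t ω})
  have b₂ := hM.real_two_le_increment_le htu
  have b₃ := hM.real_inter_one_le_increment htu hC'
  have b₄ := hM.real_completion_le hk hkB htu
  have b₅ : P.real (V ∩ R) = (1 - Real.exp (-(μ * h))) * P.real V := by
    rw [Measure.real, hS, ENNReal.toReal_mul, ENNReal.toReal_ofReal, Measure.real]
    rw [sub_nonneg, Real.exp_le_one_iff]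
    have := mul_nonneg hM.rate_pos.le h.coe_nonneg
    linarith
  have b₆ := hM.real_event_le hk hkB htu
  have ha := sub_nonneg.2 (hM.monotone_intensity htu)
  have hb : 0 ≤ μ * ((u : ℝ) - t) := mul_nonneg hM.rate_pos.le (sub_nonneg.2 htu)
  have c₁ := one_sub_exp_neg_le (L u - L t)
  have c₂ := one_sub_exp_neg_le (μ * (u - t))
  have hV : 0 ≤ P.real V := measureReal_nonneg
  have hCn : 0 ≤ P.real C' := measureReal_nonneg
  rw [hcoe] at b₅
  have d₁ : P.real C' * (1 - Real.exp (-(L u - L t))) ≤ μ * (u - t) * (L u - L t) :=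
    (mul_le_mul_of_nonneg_left c₁ hCn).trans (mul_le_mul_of_nonneg_right b₄ ha)
  have d₂ : (1 - Real.exp (-(μ * (u - t)))) * P.real V ≤
      μ * (u - t) * (L u - L t + μ * (u - t)) :=
    (mul_le_mul_of_nonneg_right c₂ hV).trans (mul_le_mul_of_nonneg_left b₆ hb)
  -- With `a = L u - L t` and `b = μ (u - t)` the three exceptional sets contribute at most `a ^ 2`,
  -- `b * a` and `b * (a + b)`, whose sum is `(a + b) ^ 2`.
  nlinarith

end IsQueueModel

/-- A continuous function on `[0, ∞)` with a continuous right derivative is differentiable. -/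
lemma hasDerivWithinAt_Ici_zero_of_right {f f' : ℝ → ℝ} (hf : ContinuousOn f (Ici 0))
    (hf' : ContinuousOn f' (Ici 0)) (h : ∀ t, 0 ≤ t → HasDerivWithinAt f (f' t) (Ici t) t)
    {t : ℝ} (ht : 0 ≤ t) : HasDerivWithinAt f (f' t) (Ici 0) t := by
  have hg : Continuous fun s => f' (max s 0) :=
    hf'.comp_continuous (by fun_prop) fun s => mem_Ici.2 (le_max_right _ _)
  -- The fundamental theorem of calculus needs only right derivatives, so `f` is a primitive of a
  -- continuous function; `max v 0` extends the integrand continuously to negative arguments.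
  have heq : ∀ s ∈ Ici (0 : ℝ), f s = f 0 + ∫ v in (0 : ℝ)..s, f' (max v 0) := by
    intro s hs
    have h1 := intervalIntegral.integral_eq_sub_of_hasDeriv_right (f := f)
      (f' := fun v => f' (max v 0)) (a := 0) (b := s)
      (hf.mono (by rw [uIcc_of_le hs]; exact Icc_subset_Ici_self))
      (fun v hv => ?_) (hg.intervalIntegrable _ _)
    · rw [h1]
      ring
    · rw [min_eq_left hs] at hv
      simp only [max_eq_left hv.1.le]
      exact (h v hv.1.le).mono Ioi_subset_Ici_self
  have h2 : HasDerivAt (fun s => f 0 + ∫ v in (0 : ℝ)..s, f' (max v 0)) (f' (max t 0)) t :=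
    (intervalIntegral.integral_hasDerivAt_right (hg.intervalIntegrable _ _)
      (hg.stronglyMeasurableAtFilter _ _) hg.continuousAt).const_add _
  rw [max_eq_left ht] at h2
  exact h2.hasDerivWithinAt.congr heq (heq t ht)

/-! ### Kolmogorov forward equations -/

namespace IsQueueModel

variable {Ω : Type*} [mΩ : MeasurableSpace Ω] {P : Measure Ω} [IsProbabilityMeasure P]
  {L lam : ℝ → ℝ} {μ : ℝ} {N : ℝ≥0 → Ω → ℕ} {S : ℕ → Ω → ℝ} {k B : ℕ}
  (hM : IsQueueModel P L μ N S) (hk : 1 ≤ k) (hkB : k ≤ B)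
include hM hk hkB

lemma continuous_stateProb (hL : Continuous L) (F : Set (Bool × ℕ)) :
    Continuous (stateProb P k B N S F) := by
  -- State probabilities at negative times equal those at `0`, because of `toNNReal`; hence the
  -- truncations on the right.
  have hbound : ∀ t u : ℝ, |stateProb P k B N S F u - stateProb P k B N S F t| ≤
      |(L (max u 0) + μ * max u 0) - (L (max t 0) + μ * max t 0)| := by
    have hle : ∀ t u : ℝ, t ≤ u → |stateProb P k B N S F u - stateProb P k B N S F t| ≤
      |(L (max u 0) + μ * max u 0) - (L (max t 0) + μ * max t 0)| := by
      intro t u htu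
      have := hM.abs_stateProb_sub_le hk hkB (Real.toNNReal_le_toNNReal htu) F
      simp only [Real.coe_toNNReal'] at this
      have e : ∀ v, stateProb P k B N S F (max v 0) = stateProb P k B N S F v := by
        intro v
        rw [← Real.coe_toNNReal', stateProb, stateProb, Real.toNNReal_coe]
      rw [e, e] at this
      refine this.trans (le_trans (le_of_eq ?_) (le_abs_self _))
      ring
    intro t u
    rcases le_total t u with h | h
    · exact hle t u h
    · rw [abs_sub_comm, abs_sub_comm (L _ + _)]
      exact hle u t h
  have hcont : Continuous fun u => L (max u 0) + μ * max u 0 := by fun_prop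
  rw [Metric.continuous_iff] at hcont ⊢
  intro t ε hε
  obtain ⟨δ, hδ, h⟩ := hcont t ε hε
  refine ⟨δ, hδ, fun u hu => lt_of_le_of_lt ?_ (h u hu)⟩
  rw [Real.dist_eq, Real.dist_eq]
  exact hbound t u

/-- The main term `Φ` of the expansion is differentiable in `u`, and the remainder is bounded by a
square whose derivative at `u = t` vanishes. -/
lemma hasDerivWithinAt_stateProb_right (hL : ∀ t, HasDerivAt L (lam t) t) (F : Set (Bool × ℕ))
    {t : ℝ} (ht : 0 ≤ t) :
    HasDerivWithinAt (stateProb P k B N S F)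
      (lam t * (stateProb P k B N S (afterArrival k ⁻¹' F) t - stateProb P k B N S F t) +
        μ * (stateProb P k B N S (afterCompletion k B ⁻¹' F ∩ busyStates) t -
          stateProb P k B N S (F ∩ busyStates) t)) (Ici t) t := by
  set Φ : ℝ → ℝ := fun u =>
    (stateProb P k B N S (F ∩ idleStates) t +
        Real.exp (-(μ * (u - t))) * stateProb P k B N S (F ∩ busyStates) t) *
          poissonWeight (L u - L t) 0 +
      (stateProb P k B N S (afterArrival k ⁻¹' F ∩ idleStates) t +
        Real.exp (-(μ * (u - t))) * stateProb P k B N S (afterArrival k ⁻¹' F ∩ busyStates) t) *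
          poissonWeight (L u - L t) 1 +
      (1 - Real.exp (-(μ * (u - t)))) *
        stateProb P k B N S (afterCompletion k B ⁻¹' F ∩ busyStates) t *
          poissonWeight (L u - L t) 0 with hΦ
  have hR : ∀ u, t ≤ u → |stateProb P k B N S F u - Φ u| ≤ (L u - L t + μ * (u - t)) ^ 2 := by
    intro u htu
    have := hM.abs_stateProb_sub_expansion_le hk hkB (t := ⟨t, ht⟩) (u := ⟨u, ht.trans htu⟩) htu F
    exact this
  have hexp : HasDerivAt (fun u => Real.exp (-(μ * (u - t)))) (-μ) t := by
    have h1 : HasDerivAt (fun u : ℝ => -(μ * (u - t))) (-μ) t := by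
      simpa using (((hasDerivAt_id t).sub_const t).const_mul μ).fun_neg
    simpa using h1.exp
  have hLt : HasDerivAt (fun u => L u - L t) (lam t) t := (hL t).sub_const _
  have hw₀ : HasDerivAt (fun u => poissonWeight (L u - L t) 0) (-lam t) t := by
    simpa [poissonWeight] using hLt.fun_neg.exp
  have hw₁ : HasDerivAt (fun u => poissonWeight (L u - L t) 1) (lam t) t := by
    simpa [poissonWeight] using hLt.fun_neg.exp.fun_mul hLt
  have hΦ' := (((hexp.mul_const (stateProb P k B N S (F ∩ busyStates) t)).const_add
      (stateProb P k B N S (F ∩ idleStates) t)).fun_mul hw₀).fun_add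
    (((hexp.mul_const (stateProb P k B N S (afterArrival k ⁻¹' F ∩ busyStates) t)).const_add
      (stateProb P k B N S (afterArrival k ⁻¹' F ∩ idleStates) t)).fun_mul hw₁) |>.fun_add
    (((hexp.const_sub 1).mul_const
      (stateProb P k B N S (afterCompletion k B ⁻¹' F ∩ busyStates) t)).fun_mul hw₀)
  have hRt : stateProb P k B N S F t - Φ t = 0 := by
    have := hR t le_rfl
    simp only [sub_self, mul_zero, add_zero, ne_eq, OfNat.ofNat_ne_zero, not_false_eq_true,
      zero_pow] at this
    exact abs_nonpos_iff.1 this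
  have hsq : HasDerivAt (fun u => (L u - L t + μ * (u - t)) ^ 2) 0 t := by
    have h1 : HasDerivAt (fun u => L u - L t + μ * (u - t)) (lam t + μ) t := by
      simpa using hLt.fun_add (((hasDerivAt_id t).sub_const t).const_mul μ)
    simpa using h1.fun_pow 2
  have hR' : HasDerivWithinAt (fun u => stateProb P k B N S F u - Φ u) 0 (Ici t) t := by
    have h1 := hasDerivAt_iff_isLittleO.1 hsq
    rw [hasDerivWithinAt_iff_isLittleO]
    refine Asymptotics.IsBigO.trans_isLittleO (Asymptotics.IsBigO.of_bound 1 ?_)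
      (h1.mono nhdsWithin_le_nhds)
    filter_upwards [self_mem_nhdsWithin] with u hu
    simpa [hRt] using hR u hu
  have hadd := hR'.fun_add hΦ'.hasDerivWithinAt
  have hi := hM.stateProb_idle_add_busy hk hkB F t
  have hi' := hM.stateProb_idle_add_busy hk hkB (afterArrival k ⁻¹' F) t
  refine (hadd.congr_of_eventuallyEq ?_ ?_).congr_deriv ?_
  · filter_upwards with u
    simp only [hΦ]
    ring
  · simp only [hΦ]
    ring
  · simp only [sub_self, mul_zero, neg_zero, Real.exp_zero, poissonWeight, pow_zero, mul_one,
      Nat.factorial_zero, Nat.cast_one, div_one, pow_one, Nat.factorial_one, one_mul, zero_mul,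
      zero_add, add_zero, ← hi, ← hi']
    ring

lemma hasDerivWithinAt_stateProb (hL : ∀ t, HasDerivAt L (lam t) t) (hlam : Continuous lam)
    (F : Set (Bool × ℕ)) {t : ℝ} (ht : 0 ≤ t) :
    HasDerivWithinAt (stateProb P k B N S F)
      (lam t * (stateProb P k B N S (afterArrival k ⁻¹' F) t - stateProb P k B N S F t) +
        μ * (stateProb P k B N S (afterCompletion k B ⁻¹' F ∩ busyStates) t -
          stateProb P k B N S (F ∩ busyStates) t)) (Ici 0) t := by
  have hLc : Continuous L := continuous_iff_continuousAt.2 fun t => (hL t).continuousAt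
  have hc := hM.continuous_stateProb hk hkB hLc
  exact hasDerivWithinAt_Ici_zero_of_right (f' := fun t =>
    lam t * (stateProb P k B N S (afterArrival k ⁻¹' F) t - stateProb P k B N S F t) +
        μ * (stateProb P k B N S (afterCompletion k B ⁻¹' F ∩ busyStates) t -
          stateProb P k B N S (F ∩ busyStates) t)) (hc F).continuousOn
    ((hlam.mul ((hc _).sub (hc _))).add (continuous_const.mul ((hc _).sub (hc _)))).continuousOn
    (fun t ht => hM.hasDerivWithinAt_stateProb_right hk hkB hL F ht) ht

omit hM hk hkB [IsProbabilityMeasure P] in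
lemma stateProb_empty (t : ℝ) : stateProb P k B N S ∅ t = 0 := by
  simp [stateProb]

lemma stateProb_busy_Icc (t : ℝ) (l u : ℕ) :
    stateProb P k B N S {z | z.1 = true ∧ z.2 ∈ Finset.Icc l u} t =
      ∑ i ∈ Finset.Icc l u, stateProb P k B N S {(true, i)} t := by
  have : {ω | queueState (phase k B (fun v => N v ω) (fun i => S i ω) t.toNNReal) ∈
      ({z | z.1 = true ∧ z.2 ∈ Finset.Icc l u} : Set (Bool × ℕ))} =
      ⋃ i ∈ Finset.Icc l u, {ω | queueState (phase k B (fun v => N v ω) (fun i => S i ω)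
        t.toNNReal) ∈ ({(true, i)} : Set (Bool × ℕ))} := by
    ext ω
    simp [Prod.ext_iff, and_comm]
  rw [stateProb, this, measureReal_biUnion_finset]
  · rfl
  · intro i _ j _ hij
    rw [Function.onFun, disjoint_left]
    intro ω h h'
    simp only [mem_ofPred_eq, mem_singleton_iff] at h h'
    rw [h] at h'
    exact hij (Prod.ext_iff.1 h').2
  · exact fun i _ => hM.measurableSet_state hk hkB _ _

lemma hasDerivWithinAt_idle_zero (hL : ∀ t, HasDerivAt L (lam t) t) (hlam : Continuous lam)
    {t : ℝ} (ht : 0 ≤ t) :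
    HasDerivWithinAt (stateProb P k B N S {(false, 0)})
      (-lam t * stateProb P k B N S {(false, 0)} t + μ * stateProb P k B N S {(true, 0)} t)
      (Ici 0) t := by
  refine (hM.hasDerivWithinAt_stateProb hk hkB hL hlam {(false, 0)} ht).congr_deriv ?_
  have h1 : afterArrival k ⁻¹' {(false, 0)} = ∅ := by
    ext ⟨_ | _, n⟩
    · simp only [mem_preimage, afterArrival, mem_singleton_iff]
      split_ifs <;> simp
    · simp [afterArrival]
  have h2 : afterCompletion k B ⁻¹' {(false, 0)} ∩ busyStates = {(true, 0)} := by
    ext ⟨_ | _, n⟩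
    · simp [busyStates]
    · simp only [mem_preimage, afterCompletion, mem_singleton_iff, busyStates, mem_inter_iff,
        mem_ofPred_eq]
      split_ifs <;> simp
      omega
  have h3 : ({(false, 0)} : Set (Bool × ℕ)) ∩ busyStates = ∅ := by
    ext ⟨_ | _, n⟩ <;> simp [busyStates]
  rw [h1, h2, h3, stateProb_empty]
  ring

/-- Because `r + 1 < k`, the arrival at `(false, r)` starts no service and a completion with `r + 1`
waiting leaves the server idle; these are the only ways in. -/
lemma hasDerivWithinAt_idle_succ (hL : ∀ t, HasDerivAt L (lam t) t) (hlam : Continuous lam)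
    {r : ℕ} (hr : r + 1 < k) {t : ℝ} (ht : 0 ≤ t) :
    HasDerivWithinAt (stateProb P k B N S {(false, r + 1)})
      (-lam t * stateProb P k B N S {(false, r + 1)} t +
        lam t * stateProb P k B N S {(false, r)} t + μ * stateProb P k B N S {(true, r + 1)} t)
      (Ici 0) t := by
  refine (hM.hasDerivWithinAt_stateProb hk hkB hL hlam {(false, r + 1)} ht).congr_deriv ?_
  have h1 : afterArrival k ⁻¹' {(false, r + 1)} = {(false, r)} := by
    ext ⟨_ | _, n⟩
    · simp only [mem_preimage, afterArrival, mem_singleton_iff]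
      split_ifs <;> simp
      omega
    · simp [afterArrival]
  have h2 : afterCompletion k B ⁻¹' {(false, r + 1)} ∩ busyStates = {(true, r + 1)} := by
    ext ⟨_ | _, n⟩
    · simp [busyStates]
    · simp only [mem_preimage, afterCompletion, mem_singleton_iff, busyStates, mem_inter_iff,
        mem_ofPred_eq]
      split_ifs <;> simp
      omega
  have h3 : ({(false, r + 1)} : Set (Bool × ℕ)) ∩ busyStates = ∅ := by
    ext ⟨_ | _, n⟩ <;> simp [busyStates]
  rw [h1, h2, h3, stateProb_empty]
  ring

/-- An empty queue behind a busy server arises from the `k`-th arrival at an idle server, or from a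
completion with `k ≤ i ≤ B` waiting, all of whom are taken. -/
lemma hasDerivWithinAt_busy_zero (hL : ∀ t, HasDerivAt L (lam t) t) (hlam : Continuous lam)
    {t : ℝ} (ht : 0 ≤ t) :
    HasDerivWithinAt (stateProb P k B N S {(true, 0)})
      (-(lam t + μ) * stateProb P k B N S {(true, 0)} t +
        (μ * ∑ i ∈ Finset.Icc k B, stateProb P k B N S {(true, i)} t +
          lam t * stateProb P k B N S {(false, k - 1)} t)) (Ici 0) t := by
  refine (hM.hasDerivWithinAt_stateProb hk hkB hL hlam {(true, 0)} ht).congr_deriv ?_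
  have h1 : afterArrival k ⁻¹' {(true, 0)} = {(false, k - 1)} := by
    ext ⟨_ | _, n⟩
    · simp only [mem_preimage, afterArrival, mem_singleton_iff]
      split_ifs <;> simp <;> omega
    · simp [afterArrival]
  have h2 : afterCompletion k B ⁻¹' {(true, 0)} ∩ busyStates =
      {z | z.1 = true ∧ z.2 ∈ Finset.Icc k B} := by
    ext ⟨_ | _, n⟩
    · simp [busyStates]
    · simp only [mem_preimage, afterCompletion, mem_singleton_iff, busyStates, mem_inter_iff,
        mem_ofPred_eq]
      split_ifs <;> simp <;> omega
  have h3 : ({(true, 0)} : Set (Bool × ℕ)) ∩ busyStates = {(true, 0)} := by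
    ext ⟨_ | _, n⟩ <;> simp [busyStates]
  rw [h1, h2, h3, hM.stateProb_busy_Icc hk hkB]
  ring

/-- A nonempty queue after a completion means that the batch was full, so exactly `n + 1 + B` were
waiting. -/
lemma hasDerivWithinAt_busy_succ (hL : ∀ t, HasDerivAt L (lam t) t) (hlam : Continuous lam)
    (n : ℕ) {t : ℝ} (ht : 0 ≤ t) :
    HasDerivWithinAt (stateProb P k B N S {(true, n + 1)})
      (-(lam t + μ) * stateProb P k B N S {(true, n + 1)} t +
        lam t * stateProb P k B N S {(true, n)} t +
          μ * stateProb P k B N S {(true, n + 1 + B)} t) (Ici 0) t := by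
  refine (hM.hasDerivWithinAt_stateProb hk hkB hL hlam {(true, n + 1)} ht).congr_deriv ?_
  have h1 : afterArrival k ⁻¹' {(true, n + 1)} = {(true, n)} := by
    ext ⟨_ | _, i⟩
    · simp only [mem_preimage, afterArrival, mem_singleton_iff]
      split_ifs <;> simp
    · simp [afterArrival]
  have h2 : afterCompletion k B ⁻¹' {(true, n + 1)} ∩ busyStates = {(true, n + 1 + B)} := by
    ext ⟨_ | _, i⟩
    · simp [busyStates]
    · simp only [mem_preimage, afterCompletion, mem_singleton_iff, busyStates, mem_inter_iff,
        mem_ofPred_eq]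
      split_ifs <;> simp <;> omega
  have h3 : ({(true, n + 1)} : Set (Bool × ℕ)) ∩ busyStates = {(true, n + 1)} := by
    ext ⟨_ | _, n⟩ <;> simp [busyStates]
  rw [h1, h2, h3]
  ring

lemma stateProb_zero (F : Set (Bool × ℕ)) [Decidable ((false, 0) ∈ F)] :
    stateProb P k B N S F 0 = if (false, 0) ∈ F then 1 else 0 := by
  have : ∀ ω, phase k B (fun v => N v ω) (fun i => S i ω) (0 : ℝ).toNNReal = (false, 0, 0) := by
    intro ω
    have h0 := hM.zero ω
    rw [Real.toNNReal_zero, phase_eq_iff (hM.path ω) hk hkB]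
    refine ⟨by simp [completion], ?_, by simp [completion, h0]⟩
    rw [← not_le, serviceStart_le_iff (hM.path ω)]
    simp only [completion, h0]
    omega
  simp only [stateProb, this, queueState]
  split_ifs with h <;> simp [h]

end IsQueueModel

/-! ### Convolution with Poisson weights -/

/-- The sequence `0, f 0, f 1, …`. -/
def delay (f : ℕ → ℝ) : ℕ → ℝ
  | 0 => 0
  | n + 1 => f n

/-- The convolution of two sequences. -/
def conv (c w : ℕ → ℝ) (n : ℕ) : ℝ := ∑ m ∈ Finset.range (n + 1), c m * w (n - m)

/-- A shift of either factor shifts the convolution. Thus the shift caused by an arrival can be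
moved between the state probabilities and the Poisson weights. -/
lemma conv_delay_right (c w : ℕ → ℝ) (n : ℕ) : conv c (delay w) n = delay (conv c w) n := by
  cases n with
  | zero => simp [conv, delay]
  | succ n =>
    rw [conv, Finset.sum_range_succ]
    simp only [tsub_self, delay, mul_zero, add_zero, conv]
    refine Finset.sum_congr rfl fun m hm => ?_
    rw [Nat.succ_sub (by simpa [Nat.lt_succ_iff] using hm)]

lemma conv_delay_left (c w : ℕ → ℝ) (n : ℕ) : conv (delay c) w n = delay (conv c w) n := by
  cases n with
  | zero => simp [conv, delay]
  | succ n =>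
    rw [conv, Finset.sum_range_succ']
    simp [delay, conv]

lemma conv_add_left (c c' w : ℕ → ℝ) (n : ℕ) :
    conv (fun m => c m + c' m) w n = conv c w n + conv c' w n := by
  simp only [conv, add_mul, Finset.sum_add_distrib]

lemma conv_sub_right (c w w' : ℕ → ℝ) (n : ℕ) :
    conv c (fun m => w m - w' m) n = conv c w n - conv c w' n := by
  simp only [conv, mul_sub, Finset.sum_sub_distrib]

lemma conv_smul_left (r : ℝ) (c w : ℕ → ℝ) (n : ℕ) :
    conv (fun m => r * c m) w n = r * conv c w n := by
  simp only [conv, mul_assoc, Finset.mul_sum]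

lemma conv_smul_right (r : ℝ) (c w : ℕ → ℝ) (n : ℕ) :
    conv c (fun m => r * w m) n = r * conv c w n := by
  simp only [conv, Finset.mul_sum]
  exact Finset.sum_congr rfl fun m _ => by ring

lemma conv_nonneg {c w : ℕ → ℝ} (hc : ∀ m, 0 ≤ c m) (hw : ∀ m, 0 ≤ w m) (n : ℕ) :
    0 ≤ conv c w n :=
  Finset.sum_nonneg fun m _ => mul_nonneg (hc m) (hw _)

lemma HasDerivWithinAt.conv {c w : ℕ → ℝ → ℝ} {c' w' : ℕ → ℝ} {s : Set ℝ} {t : ℝ}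
    (hc : ∀ m, HasDerivWithinAt (c m) (c' m) s t) (hw : ∀ m, HasDerivWithinAt (w m) (w' m) s t)
    (n : ℕ) : HasDerivWithinAt (fun v => conv (fun m => c m v) (fun m => w m v) n)
      (BulkQueue.conv c' (fun m => w m t) n + BulkQueue.conv (fun m => c m t) w' n) s t := by
  simp only [BulkQueue.conv, ← Finset.sum_add_distrib]
  exact HasDerivWithinAt.fun_sum fun m _ => (hc m).fun_mul (hw (n - m))

lemma Continuous.conv {c w : ℕ → ℝ → ℝ} (hc : ∀ m, Continuous (c m))
    (hw : ∀ m, Continuous (w m)) (n : ℕ) :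
    Continuous fun v => conv (fun m => c m v) (fun m => w m v) n :=
  continuous_finsetSum _ fun m _ => (hc m).mul (hw (n - m))

lemma hasDerivAt_poissonWeight (r : ℝ) (m : ℕ) :
    HasDerivAt (fun r => poissonWeight r m) (delay (poissonWeight r) m - poissonWeight r m) r := by
  have h1 : HasDerivAt (fun r : ℝ => Real.exp (-r)) (-Real.exp (-r)) r := by
    simpa using (hasDerivAt_neg r).exp
  refine ((h1.fun_mul (hasDerivAt_pow m r)).div_const (m.factorial : ℝ)).congr_deriv ?_
  cases m with
  | zero => simp [delay, poissonWeight]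
  | succ m =>
    simp only [delay, poissonWeight, Nat.factorial_succ, Nat.cast_mul]
    have h2 : ((m + 1 : ℕ) : ℝ) ≠ 0 := by positivity
    have h3 : (m.factorial : ℝ) ≠ 0 := by positivity
    field_simp
    simp only [Nat.add_sub_cancel]
    ring

lemma HasDerivAt.poissonWeight {f : ℝ → ℝ} {f' x : ℝ} (hf : HasDerivAt f f' x) (m : ℕ) :
    HasDerivAt (fun y => poissonWeight (f y) m)
      ((delay (BulkQueue.poissonWeight (f x)) m - BulkQueue.poissonWeight (f x) m) * f') x :=
  (hasDerivAt_poissonWeight (f x) m).comp x hf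

lemma continuous_poissonWeight (m : ℕ) : Continuous fun r => poissonWeight r m :=
  continuous_iff_continuousAt.2 fun r => (hasDerivAt_poissonWeight r m).continuousAt

lemma poissonWeight_zero_left (m : ℕ) : poissonWeight 0 m = if m = 0 then 1 else 0 := by
  cases m <;> simp [poissonWeight]

/-! ### The density -/

section Density

variable {L lam : ℝ → ℝ} {μ : ℝ} {b q : ℕ → ℝ → ℝ}

/-- The density of the elapsed service time, when `b n` is the rate at which services start that
leave `n` customers in the queue. -/
noncomputable def busyDensity (L : ℝ → ℝ) (μ : ℝ) (b : ℕ → ℝ → ℝ) (n : ℕ) (x t : ℝ) : ℝ :=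
  if x ≤ t then
    Real.exp (-(μ * x)) * conv (fun m => b m (t - x)) (poissonWeight (L t - L (t - x))) n
  else 0

lemma transportRhs_eq (lam : ℝ → ℝ) (μ : ℝ) (p : ℕ → ℝ → ℝ → ℝ) (n : ℕ) (x t : ℝ) :
    transportRhs lam μ p n x t =
      -(lam t + μ) * p n x t + lam t * delay (fun n => p n x t) n := by
  cases n <;> simp [transportRhs, delay]

lemma delay_mul (r : ℝ) (f : ℕ → ℝ) (n : ℕ) : delay (fun n => r * f n) n = r * delay f n := by
  cases n <;> simp [delay]

lemma transportRhs_busyDensity_of_le {x t : ℝ} (h : x ≤ t) (n : ℕ) :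
    transportRhs lam μ (busyDensity L μ b) n x t =
      -μ * Real.exp (-(μ * x)) *
        conv (fun m => b m (t - x)) (poissonWeight (L t - L (t - x))) n +
      Real.exp (-(μ * x)) * conv (fun m => b m (t - x)) (fun m =>
        lam t * (delay (poissonWeight (L t - L (t - x))) m -
          poissonWeight (L t - L (t - x)) m)) n := by
  rw [transportRhs_eq, conv_smul_right, conv_sub_right]
  have : conv (fun m => b m (t - x)) (fun m => delay (poissonWeight (L t - L (t - x))) m) n =
      delay (conv (fun m => b m (t - x)) (poissonWeight (L t - L (t - x)))) n :=
    conv_delay_right _ _ _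
  rw [this]
  simp only [busyDensity, if_pos h, delay_mul]
  ring

lemma transportRhs_busyDensity_of_lt {x t : ℝ} (h : t < x) (n : ℕ) :
    transportRhs lam μ (busyDensity L μ b) n x t = 0 := by
  rw [transportRhs_eq]
  cases n <;> simp [delay, busyDensity, not_le.2 h]

lemma hasDerivAt_exp_neg_mul (μ x : ℝ) :
    HasDerivAt (fun y => Real.exp (-(μ * y))) (-μ * Real.exp (-(μ * x))) x := by
  have h : HasDerivAt (fun y : ℝ => -(μ * y)) (-μ) x := by
    simpa using ((hasDerivAt_id x).const_mul μ).fun_neg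
  simpa [mul_comm] using h.exp

/-- The direction `(1, 1)` keeps `t - x` fixed. Hence `b` is never differentiated, so no regularity
of it is needed, and the jump across `x = t` is never crossed. -/
lemma hasTransportDeriv_busyDensity (hL : ∀ t, HasDerivAt L (lam t) t) (n : ℕ) {x t : ℝ} :
    HasTransportDeriv (busyDensity L μ b n)
      (transportRhs lam μ (busyDensity L μ b) n x t) x t := by
  rw [HasTransportDeriv]
  rcases le_or_gt x t with h | h
  · rw [transportRhs_busyDensity_of_le h]
    have e : (fun v => busyDensity L μ b n (x + v) (t + v)) = fun v =>
        Real.exp (-(μ * (x + v))) *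
          conv (fun m => b m (t - x)) (fun m => poissonWeight (L (t + v) - L (t - x)) m) n := by
      funext v
      have h1 : t + v - (x + v) = t - x := by ring
      rw [busyDensity, if_pos (by linarith), h1]
    rw [e]
    have h1 : HasDerivAt (fun v => Real.exp (-(μ * (x + v)))) (-μ * Real.exp (-(μ * x))) 0 := by
      have := hasDerivAt_exp_neg_mul μ (x + 0)
      simpa using this.comp_const_add x 0
    have h2 : ∀ m, HasDerivAt (fun v => poissonWeight (L (t + v) - L (t - x)) m)
        (lam t * (delay (poissonWeight (L t - L (t - x))) m -
          poissonWeight (L t - L (t - x)) m)) 0 := by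
      intro m
      have h3 : HasDerivAt (fun v => L (t + v) - L (t - x)) (lam t) 0 := by
        have := hL (t + 0)
        simpa using (this.comp_const_add t 0).sub_const (L (t - x))
      have h5 := HasDerivAt.poissonWeight h3 m
      rw [add_zero] at h5
      exact h5.congr_deriv (mul_comm _ _)
    have h6 := HasDerivWithinAt.conv (s := Ici (-min x t))
      (fun m => hasDerivWithinAt_const (0 : ℝ) _ (b m (t - x)))
      (fun m => (h2 m).hasDerivWithinAt) n
    refine (h1.hasDerivWithinAt.fun_mul h6).congr_deriv ?_
    have h7 : conv (fun _ => (0 : ℝ)) (fun m => poissonWeight (L (t + 0) - L (t - x)) m) n = 0 := by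
      simp [conv]
    rw [h7]
    simp only [add_zero, zero_add]
  · rw [transportRhs_busyDensity_of_lt h]
    have e : (fun v => busyDensity L μ b n (x + v) (t + v)) = fun _ => 0 := by
      funext v
      rw [busyDensity, if_neg (by linarith)]
    rw [e]
    exact hasDerivWithinAt_const _ _ _

/-- Each partial derivative separately involves the derivative of `b` and `lam (t - x)`; both cancel
in the sum. Off the diagonal the formula chosen by the case distinction is locally constant. -/
lemma hasPartialsSum_busyDensity (hL : ∀ t, HasDerivAt L (lam t) t)
    (hb : ∀ m t, 0 < t → DifferentiableAt ℝ (b m) t) (n : ℕ) {x t : ℝ} (hx : x ≠ t) :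
    HasPartialsSum (busyDensity L μ b n)
      (transportRhs lam μ (busyDensity L μ b) n x t) x t := by
  rcases lt_or_gt_of_ne hx with h | h
  · have hs : 0 < t - x := sub_pos.2 h
    have hderiv : ∀ m, HasDerivAt (b m) (deriv (b m) (t - x)) (t - x) :=
      fun m => (hb m _ hs).hasDerivAt
    set w := poissonWeight (L t - L (t - x))
    have hbt : ∀ m, HasDerivAt (fun u => b m (u - x)) (deriv (b m) (t - x)) t :=
      fun m => (hderiv m).comp_sub_const t x
    have hbx : ∀ m, HasDerivAt (fun y => b m (t - y)) (-deriv (b m) (t - x)) x :=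
      fun m => (hderiv m).comp_const_sub t x
    have hwt : ∀ m, HasDerivAt (fun u => poissonWeight (L u - L (u - x)) m)
        ((delay w m - w m) * (lam t - lam (t - x))) t := fun m =>
      HasDerivAt.poissonWeight ((hL t).fun_sub ((hL (t - x)).comp_sub_const t x)) m
    have hwx : ∀ m, HasDerivAt (fun y => poissonWeight (L t - L (t - y)) m)
        ((delay w m - w m) * lam (t - x)) x := fun m => by
      have := HasDerivAt.poissonWeight (((hL (t - x)).comp_const_sub t x).const_sub (L t)) m
      rwa [neg_neg] at this
    have ht := ((HasDerivWithinAt.conv (s := Ici 0) (fun m => (hbt m).hasDerivWithinAt)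
      (fun m => (hwt m).hasDerivWithinAt) n).const_mul (Real.exp (-(μ * x))))
    have hxx := (hasDerivAt_exp_neg_mul μ x).hasDerivWithinAt.fun_mul
      (HasDerivWithinAt.conv (s := Ici 0) (fun m => (hbx m).hasDerivWithinAt)
      (fun m => (hwx m).hasDerivWithinAt) n)
    refine ⟨_, _, ht.congr_of_eventuallyEq ?_ ?_, hxx.congr_of_eventuallyEq ?_ ?_, ?_⟩
    · filter_upwards [mem_nhdsWithin_of_mem_nhds (lt_mem_nhds h)] with u hu
      rw [busyDensity, if_pos (le_of_lt hu)]
    · rw [busyDensity, if_pos h.le]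
    · filter_upwards [mem_nhdsWithin_of_mem_nhds (gt_mem_nhds h)] with y hy
      rw [busyDensity, if_pos (le_of_lt hy)]
    · rw [busyDensity, if_pos h.le]
    · rw [transportRhs_busyDensity_of_le h.le]
      have e₁ : ∀ r : ℝ, conv (fun m => b m (t - x)) (fun m => (delay w m - w m) * r) n =
          r * conv (fun m => b m (t - x)) (fun m => delay w m - w m) n := by
        intro r
        rw [← conv_smul_right]
        simp only [mul_comm]
      have e₂ : conv (fun m => -deriv (b m) (t - x)) w n =
          -conv (fun m => deriv (b m) (t - x)) w n := by
        simp [conv]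
      have e₃ : (fun m => poissonWeight (L t - L (t - x)) m) = w := rfl
      rw [conv_smul_right]
      simp only [e₁, e₃, e₂]
      ring
  · rw [transportRhs_busyDensity_of_lt h]
    refine ⟨0, 0, (hasDerivWithinAt_const t (Ici 0) (0 : ℝ)).congr_of_eventuallyEq ?_ ?_,
      (hasDerivWithinAt_const x (Ici 0) (0 : ℝ)).congr_of_eventuallyEq ?_ ?_, add_zero 0⟩
    · filter_upwards [mem_nhdsWithin_of_mem_nhds (gt_mem_nhds h)] with u hu
      rw [busyDensity, if_neg (not_le.2 hu)]
    · rw [busyDensity, if_neg (not_le.2 h)]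
    · filter_upwards [mem_nhdsWithin_of_mem_nhds (lt_mem_nhds h)] with y hy
      rw [busyDensity, if_neg (not_le.2 hy)]
    · rw [busyDensity, if_neg (not_le.2 h)]

lemma busyDensity_zero_left (n : ℕ) {t : ℝ} (ht : 0 ≤ t) :
    busyDensity L μ b n 0 t = b n t := by
  rw [busyDensity, if_pos ht, conv, Finset.sum_range_succ, Finset.sum_eq_zero]
  · simp [poissonWeight_zero_left]
  · intro m hm
    have : n - m ≠ 0 := by have := Finset.mem_range.1 hm; omega
    simp [poissonWeight_zero_left, this]

lemma busyDensity_nonneg (hL : ∀ s t, 0 ≤ s → s ≤ t → L s ≤ L t)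
    (hb : ∀ n t, 0 ≤ t → 0 ≤ b n t) (n : ℕ) {x t : ℝ} (hx : 0 ≤ x) :
    0 ≤ busyDensity L μ b n x t := by
  rw [busyDensity]
  split_ifs with h
  · exact mul_nonneg (Real.exp_pos _).le (conv_nonneg (fun m => hb m _ (sub_nonneg.2 h))
      (fun m => poissonWeight_nonneg
        (sub_nonneg.2 (hL _ _ (sub_nonneg.2 h) (by linarith))) m) n)
  · exact le_rfl

lemma measurable_busyDensity (hL : Continuous L) (hb : ∀ n, Continuous (b n)) (n : ℕ) (t : ℝ) :
    Measurable fun x => busyDensity L μ b n x t := by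
  refine Measurable.ite measurableSet_Iic (Continuous.measurable ?_) measurable_const
  exact Continuous.mul (by fun_prop) (Continuous.conv (fun m => (hb m).comp (by fun_prop))
    (fun m => (continuous_poissonWeight m).comp (by fun_prop)) n)

/-- The tail of the density in the elapsed service time, when the busy states satisfy their
forward equations. -/
lemma integral_busyDensity (hL : ∀ t, HasDerivAt L (lam t) t) (hb : ∀ n, Continuous (b n))
    (hq : ∀ n t, 0 ≤ t → HasDerivWithinAt (q n)
      (-(lam t + μ) * q n t + lam t * delay (fun n => q n t) n + b n t) (Ici 0) t)
    (hq0 : ∀ n, q n 0 = 0) (n : ℕ) {x t : ℝ} (hxt : x ≤ t) :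
    ∫ y in x..t, busyDensity L μ b n y t =
      Real.exp (-(μ * x)) * conv (fun m => q m (t - x)) (poissonWeight (L t - L (t - x))) n := by
  have hLc : Continuous L := continuous_iff_continuousAt.2 fun t => (hL t).continuousAt
  set g : ℝ → ℝ := fun s =>
    Real.exp (-(μ * (t - s))) * conv (fun m => b m s) (poissonWeight (L t - L s)) n with hg
  set G : ℝ → ℝ := fun s =>
    Real.exp (-(μ * (t - s))) * conv (fun m => q m s) (poissonWeight (L t - L s)) n with hG
  have hgc : Continuous g := Continuous.mul (by fun_prop) (Continuous.conv (fun m => hb m)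
    (fun m => (continuous_poissonWeight m).comp (by fun_prop)) n)
  -- In the forward equations of `q`, the loss terms and the gain by arrivals are cancelled by the
  -- derivatives of the exponential and of the Poisson weights; only the source `b` survives.
  have hGd : ∀ s, 0 ≤ s → HasDerivWithinAt G (g s) (Ici 0) s := by
    intro s hs
    set w := poissonWeight (L t - L s)
    have hw : ∀ m, HasDerivAt (fun v => poissonWeight (L t - L v) m)
        (-lam s * (delay w m - w m)) s := fun m => by
      have := HasDerivAt.poissonWeight ((hL s).const_sub (L t)) m
      exact this.congr_deriv (mul_comm _ _)
    have he : HasDerivAt (fun v => Real.exp (-(μ * (t - v)))) (μ * Real.exp (-(μ * (t - s)))) s := by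
      have := (hasDerivAt_exp_neg_mul μ (t - s)).comp_const_sub t s
      simpa using this
    have h1 := he.hasDerivWithinAt.fun_mul (HasDerivWithinAt.conv (s := Ici 0)
      (fun m => hq m s hs) (fun m => (hw m).hasDerivWithinAt) n)
    refine h1.congr_deriv ?_
    have e₃ : (fun m => poissonWeight (L t - L s) m) = w := rfl
    simp only [e₃, conv_add_left, conv_smul_left, conv_smul_right, conv_sub_right]
    have e₁ : conv (fun m => delay (fun n => q n s) m) w n = delay (conv (fun m => q m s) w) n :=
      conv_delay_left _ _ _
    have e₂ : conv (fun m => q m s) (fun m => delay w m) n = delay (conv (fun m => q m s) w) n :=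
      conv_delay_right _ _ _
    simp only [e₁, e₂, hg]
    ring
  have hG0 : G 0 = 0 := by simp [hG, hq0, conv]
  have hts : 0 ≤ t - x := sub_nonneg.2 hxt
  have hint : ∫ s in (0 : ℝ)..(t - x), g s = G (t - x) - G 0 := by
    refine intervalIntegral.integral_eq_sub_of_hasDeriv_right (fun s hs => ?_) (fun s hs => ?_)
      (hgc.intervalIntegrable _ _)
    · rw [uIcc_of_le hts] at hs
      exact (hGd s hs.1).continuousWithinAt.mono fun v hv => by
        rw [uIcc_of_le hts] at hv
        exact hv.1
    · rw [min_eq_left hts] at hs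
      exact (hGd s hs.1.le).mono fun v hv => hs.1.le.trans (le_of_lt hv)
  have hcongr : ∫ y in x..t, busyDensity L μ b n y t = ∫ y in x..t, g (t - y) := by
    refine intervalIntegral.integral_congr fun y hy => ?_
    rw [uIcc_of_le hxt] at hy
    simp only [busyDensity, if_pos hy.2, hg, sub_sub_cancel]
  rw [hcongr, intervalIntegral.integral_comp_sub_left (fun s => g s), sub_self, hint, hG0, sub_zero]
  simp only [hG, sub_sub_cancel]

end Density

lemma lintegral_Ioi_busyDensity {L : ℝ → ℝ} {μ : ℝ} {b : ℕ → ℝ → ℝ} (hL : Continuous L)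
    (hLm : ∀ s t, 0 ≤ s → s ≤ t → L s ≤ L t) (hb : ∀ n, Continuous (b n))
    (hb0 : ∀ n t, 0 ≤ t → 0 ≤ b n t) (n : ℕ) {a t : ℝ} (ha : 0 ≤ a) (hat : a ≤ t) :
    ∫⁻ x in Ioi a, ENNReal.ofReal (busyDensity L μ b n x t) =
      ENNReal.ofReal (∫ x in a..t, busyDensity L μ b n x t) := by
  rw [← Ioc_union_Ioi_eq_Ioi hat, lintegral_union measurableSet_Ioi
    (disjoint_left.2 fun x h h' => absurd h.2 (not_le.2 h'))]
  have h1 : ∫⁻ x in Ioi t, ENNReal.ofReal (busyDensity L μ b n x t) = 0 := by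
    rw [setLIntegral_congr_fun (g := fun _ => 0) measurableSet_Ioi, lintegral_zero]
    intro x hx
    simp only
    rw [busyDensity, if_neg (not_le.2 hx), ENNReal.ofReal_zero]
  have hcont : Continuous fun x => Real.exp (-(μ * x)) *
      conv (fun m => b m (t - x)) (poissonWeight (L t - L (t - x))) n :=
    Continuous.mul (by fun_prop) (Continuous.conv (fun m => (hb m).comp (by fun_prop))
      (fun m => (continuous_poissonWeight m).comp (by fun_prop)) n)
  have hint : IntegrableOn (fun x => busyDensity L μ b n x t) (Ioc a t) :=
    (hcont.integrableOn_Ioc).congr_fun (fun x hx => by simp only [busyDensity, if_pos hx.2])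
      measurableSet_Ioc
  rw [h1, add_zero, intervalIntegral.integral_of_le hat,
    ofReal_integral_eq_lintegral_ofReal hint]
  filter_upwards [ae_restrict_mem measurableSet_Ioc] with x hx
  exact busyDensity_nonneg hLm hb0 n (ha.trans hx.1.le)

/-- The rate at which services start that leave `n` customers in the queue. -/
noncomputable def startRate {Ω : Type*} [MeasurableSpace Ω] (P : Measure Ω) (k B : ℕ)
    (N : ℝ≥0 → Ω → ℕ) (S : ℕ → Ω → ℝ) (lam : ℝ → ℝ) (μ : ℝ) : ℕ → ℝ → ℝ
  | 0, t => μ * ∑ i ∈ Finset.Icc k B, stateProb P k B N S {(true, i)} t +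
      lam t * stateProb P k B N S {(false, k - 1)} t
  | n + 1, t => μ * stateProb P k B N S {(true, n + 1 + B)} t

/-! ### Identification of the density -/

namespace IsQueueModel

variable {Ω : Type*} [mΩ : MeasurableSpace Ω] {P : Measure Ω} [IsProbabilityMeasure P]
  {L lam : ℝ → ℝ} {μ : ℝ} {N : ℝ≥0 → Ω → ℕ} {S : ℕ → Ω → ℝ} {k B : ℕ}
  (hM : IsQueueModel P L μ N S)
include hM

omit [IsProbabilityMeasure P] in
lemma intensity_le (s t : ℝ) (hs : 0 ≤ s) (hst : s ≤ t) : L s ≤ L t :=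
  hM.monotone_intensity (t := ⟨s, hs⟩) (u := ⟨t, hs.trans hst⟩) hst

variable (hk : 1 ≤ k) (hkB : k ≤ B)
include hk hkB

omit [IsProbabilityMeasure P] in
lemma idleProb_eq (r : ℕ) : idleProb P k B N S r = stateProb P k B N S {(false, r)} := by
  funext t
  rw [idleProb, stateProb]
  congr 1
  ext ω
  simp only [mem_ofPred_eq, mem_singleton_iff]
  constructor
  · rintro ⟨j, hj⟩
    rw [(phase_eq_iff (hM.path ω) hk hkB (z := (false, j, r))).2 hj]
    rfl
  · intro h
    have hz := inPhase_phase (s := fun i => S i ω) (t := t.toNNReal) (hM.path ω) hk hkB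
    generalize phase k B (fun v => N v ω) (fun i => S i ω) t.toNNReal = z at h hz
    obtain ⟨b, j, n⟩ := z
    simp only [queueState, Prod.mk.injEq] at h
    obtain ⟨rfl, rfl⟩ := h
    exact ⟨j, hz⟩

lemma continuous_startRate (hL : Continuous L) (hlam : Continuous lam)
    (n : ℕ) : Continuous (startRate P k B N S lam μ n) := by
  have hc := hM.continuous_stateProb hk hkB hL
  cases n with
  | zero =>
    exact (continuous_const.mul (continuous_finsetSum _ fun i _ => hc _)).add (hlam.mul (hc _))
  | succ n => exact continuous_const.mul (hc _)

omit hk hkB [IsProbabilityMeasure P] in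
lemma startRate_nonneg (hlam0 : ∀ t, 0 ≤ lam t) (n : ℕ) (t : ℝ) :
    0 ≤ startRate P k B N S lam μ n t := by
  have h : ∀ F, 0 ≤ stateProb P k B N S F t := fun F => measureReal_nonneg
  cases n with
  | zero =>
    exact add_nonneg (mul_nonneg hM.rate_pos.le (Finset.sum_nonneg fun i _ => h _))
      (mul_nonneg (hlam0 t) (h _))
  | succ n => exact mul_nonneg hM.rate_pos.le (h _)

lemma hasDerivWithinAt_busy (hL : ∀ t, HasDerivAt L (lam t) t) (hlam : Continuous lam)
    (n : ℕ) {t : ℝ} (ht : 0 ≤ t) :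
    HasDerivWithinAt (stateProb P k B N S {(true, n)})
      (-(lam t + μ) * stateProb P k B N S {(true, n)} t +
        lam t * delay (fun n => stateProb P k B N S {(true, n)} t) n +
          startRate P k B N S lam μ n t) (Ici 0) t := by
  cases n with
  | zero =>
    refine (hM.hasDerivWithinAt_busy_zero hk hkB hL hlam ht).congr_deriv ?_
    simp only [delay, startRate]
    ring
  | succ n => exact hM.hasDerivWithinAt_busy_succ hk hkB hL hlam n ht

lemma differentiableAt_startRate (hL : ∀ t, HasDerivAt L (lam t) t) (hlam : Continuous lam)
    (hd : ∀ t, 0 < t → DifferentiableAt ℝ lam t) (n : ℕ) {t : ℝ} (ht : 0 < t) :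
    DifferentiableAt ℝ (startRate P k B N S lam μ n) t := by
  have h : ∀ F, DifferentiableAt ℝ (stateProb P k B N S F) t := fun F =>
    ((hM.hasDerivWithinAt_stateProb hk hkB hL hlam F ht.le).hasDerivAt
      (Ici_mem_nhds ht)).differentiableAt
  cases n with
  | zero =>
    exact ((DifferentiableAt.fun_sum fun i _ => h _).const_mul μ).fun_add ((hd t ht).fun_mul (h _))
  | succ n => exact (h _).const_mul μ

/-- The distribution of the starting time of the current service. -/
lemma real_busy_inter_serviceStart_le {s t : ℝ≥0} (hst : s ≤ t) (n : ℕ) :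
    P.real {ω | ∃ j, InPhase k B (fun v => N v ω) (fun i => S i ω) t (true, j, n) ∧
        serviceStart k B (fun v => N v ω) (fun i => S i ω) j ≤ s} =
      Real.exp (-(μ * (t - s))) *
        conv (fun m => stateProb P k B N S {(true, m)} s) (poissonWeight (L t - L s)) n := by
  -- The same service is going on at `s` and at `t`: with `m` in the queue at `s`, it survives and
  -- `n - m` customers arrive. The truncation is harmless because only `m ≤ n` occurs.
  set D : ℕ → Set Ω := fun m =>
    ({ω | queueState (phase k B (fun v => N v ω) (fun i => S i ω) s) ∈
        ({(true, m)} : Set (Bool × ℕ))} ∩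
      {ω | NoCompletion k B (fun v => N v ω) (fun i => S i ω) s t}) ∩
      {ω | N t ω - N s ω = n - m} with hD
  have hset : {ω | ∃ j, InPhase k B (fun v => N v ω) (fun i => S i ω) t (true, j, n) ∧
        serviceStart k B (fun v => N v ω) (fun i => S i ω) j ≤ s} =
      ⋃ m ∈ Finset.range (n + 1), D m := by
    ext ω
    simp only [mem_ofPred_eq, mem_iUnion, hD, mem_inter_iff, mem_singleton_iff,
      Finset.mem_range, exists_prop]
    constructor
    · rintro ⟨j, hj, hs⟩
      obtain ⟨m, hm, hmn⟩ := hj.busy_of_serviceStart_le (hM.path ω) hkB hst hs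
      have hph := (phase_eq_iff (hM.path ω) hk hkB).2 hm
      refine ⟨m, by omega, ⟨⟨by rw [hph]; rfl, ?_⟩, by omega⟩⟩
      rw [NoCompletion, hph]
      exact fun _ => hj.2.1
    · rintro ⟨m, hm, ⟨hq, hc⟩, hA⟩
      have hz := inPhase_phase (s := fun i => S i ω) (t := s) (hM.path ω) hk hkB
      rw [NoCompletion] at hc
      generalize phase k B (fun v => N v ω) (fun i => S i ω) s = z at hq hc hz
      obtain ⟨b, j, m'⟩ := z
      simp only [queueState, Prod.mk.injEq] at hq
      obtain ⟨rfl, rfl⟩ := hq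
      refine ⟨j, ?_, hz.1⟩
      have := hz.busy_of_lt_completion (hM.path ω) hst (hc rfl)
      rw [hA] at this
      rwa [show m' + (n - m') = n by omega] at this
  have hE : ∀ m, MeasurableSet[servicesAndHistory N S s]
      ({ω | queueState (phase k B (fun v => N v ω) (fun i => S i ω) s) ∈
        ({(true, m)} : Set (Bool × ℕ))} ∩
      {ω | NoCompletion k B (fun v => N v ω) (fun i => S i ω) s t}) := fun m =>
    (hM.measurableSet_phase_servicesAndHistory hk hkB s (queueState ⁻¹' {(true, m)})).inter
      (hM.measurableSet_noCompletion_servicesAndHistory hk hkB s t)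
  rw [hset, measureReal_biUnion_finset]
  · rw [conv, Finset.mul_sum]
    refine Finset.sum_congr rfl fun m _ => ?_
    rw [hD, hM.real_inter_increment hst (hE m), hM.real_state_inter_noCompletion hk hkB hst]
    have h1 : ({(true, m)} : Set (Bool × ℕ)) ∩ idleStates = ∅ := by
      ext ⟨_ | _, n⟩ <;> simp [idleStates]
    have h2 : ({(true, m)} : Set (Bool × ℕ)) ∩ busyStates = {(true, m)} := by
      ext ⟨_ | _, n⟩ <;> simp [busyStates]
    rw [h1, h2, stateProb_empty]
    ring
  · intro m _ m' _ hmm'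
    rw [Function.onFun, disjoint_left]
    intro ω h h'
    have e1 : queueState (phase k B (fun v => N v ω) (fun i => S i ω) s) = (true, m) := h.1.1
    have e2 : queueState (phase k B (fun v => N v ω) (fun i => S i ω) s) = (true, m') := h'.1.1
    rw [e1] at e2
    exact hmm' (Prod.ext_iff.1 e2).2
  · exact fun m _ => (hM.servicesAndHistory_le s _ (hE m)).inter
      (hM.measurable_increment s t (measurableSet_singleton _))

/-- The law of the elapsed time, restricted to the event of being busy with `n` in the queue, is
compared with the candidate on half-lines `[a, ∞)`; these determine a finite measure. -/
lemma isBusyDensity (hL : ∀ t, HasDerivAt L (lam t) t) (hlam : Continuous lam)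
    (hlam0 : ∀ t, 0 ≤ lam t) :
    IsBusyDensity P k B N S (busyDensity L μ (startRate P k B N S lam μ)) := by
  have hLc : Continuous L := continuous_iff_continuousAt.2 fun t => (hL t).continuousAt
  have hb := hM.continuous_startRate hk hkB hLc hlam
  have hb0 : ∀ n t, 0 ≤ t → 0 ≤ startRate P k B N S lam μ n t :=
    fun n t _ => hM.startRate_nonneg hlam0 n t
  refine ⟨fun n t _ => measurable_busyDensity hLc hb n t,
    fun n x t hx _ => busyDensity_nonneg hM.intensity_le hb0 n hx, ?_⟩
  intro n t ht E hE
  lift t to ℝ≥0 using ht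
  rw [Real.toNNReal_coe]
  set J : Ω → ℕ := fun ω => (phase k B (fun v => N v ω) (fun i => S i ω) t).2.1
  have hph := measurable_phase hk hkB hM.measurable_arrivals hM.path hM.measurable_service t
  have hJ : Measurable J := hph.snd.fst
  set el : Ω → ℝ := fun ω =>
    (t : ℝ) - (serviceStart k B (fun v => N v ω) (fun i => S i ω) (J ω)).toReal
  have hel : Measurable el := measurable_random_index (f := fun j ω =>
    (t : ℝ) - (serviceStart k B (fun v => N v ω) (fun i => S i ω) j).toReal)
    (fun j => measurable_const.sub (measurable_serviceStart hM.measurable_arrivals hM.path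
      fun i _ => hM.measurable_service i).ennreal_toReal) hJ
  set D : Set Ω := {ω | queueState (phase k B (fun v => N v ω) (fun i => S i ω) t) ∈
    ({(true, n)} : Set (Bool × ℕ))}
  have hD : MeasurableSet D := hM.measurableSet_state hk hkB t _
  have hDJ : ∀ ω, ω ∈ D ↔ InPhase k B (fun v => N v ω) (fun i => S i ω) t (true, J ω, n) := by
    intro ω
    rw [← phase_eq_iff (hM.path ω) hk hkB]
    simp only [D, J, queueState, mem_ofPred_eq, mem_singleton_iff, Prod.ext_iff, true_and]
  have huniq : ∀ ω j, InPhase k B (fun v => N v ω) (fun i => S i ω) t (true, j, n) → J ω = j := by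
    intro ω j hj
    simp only [J, (phase_eq_iff (hM.path ω) hk hkB).2 hj]
  have hevent : {ω | ∃ x ∈ E, BusyAt k B (fun u => N u ω) (fun j => S j ω) t n x} =
      el ⁻¹' E ∩ D := by
    ext ω
    constructor
    · rintro ⟨x, hx, j, h1, h2, h3, rfl⟩
      have hj : InPhase k B (fun v => N v ω) (fun i => S i ω) t (true, j, n) := ⟨h1, h2, h3⟩
      have hJj := huniq ω j hj
      refine ⟨?_, (hDJ ω).2 (hJj ▸ hj)⟩
      rw [mem_preimage]
      simp only [el, hJj]
      exact hx
    · rintro ⟨hx, hω⟩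
      have hj := (hDJ ω).1 hω
      exact ⟨el ω, hx, J ω, hj.1, hj.2.1, hj.2.2, rfl⟩
  have hmeasure : (P.restrict D).map el = (volume.restrict (Ioi 0)).withDensity
      fun x => ENNReal.ofReal (busyDensity L μ (startRate P k B N S lam μ) n x t) := by
    refine Measure.ext_of_Ici _ _ fun a => ?_
    rw [Measure.map_apply hel measurableSet_Ici, Measure.restrict_apply (hel measurableSet_Ici),
      withDensity_apply _ measurableSet_Ici, Measure.restrict_restrict measurableSet_Ici]
    have hbounds : ∀ ω ∈ D, 0 ≤ el ω ∧ el ω ≤ t := by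
      intro ω hω
      have h1 : serviceStart k B (fun v => N v ω) (fun i => S i ω) (J ω) ≤ t := ((hDJ ω).1 hω).1
      have h2 := ENNReal.toReal_mono ENNReal.coe_ne_top h1
      rw [ENNReal.coe_toReal] at h2
      exact ⟨sub_nonneg.2 h2, sub_le_self _ ENNReal.toReal_nonneg⟩
    have hae : (Ici a ∩ Ioi 0 : Set ℝ) =ᵐ[volume] Ioi (max a 0) := by
      have : Ioi (max a 0) = Ioi a ∩ Ioi 0 := Ioi_inter_Ioi.symm
      rw [this]
      exact Ioi_ae_eq_Ici.symm.inter (ae_eq_refl _)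
    rw [setLIntegral_congr hae]
    rcases le_or_gt (max a 0) t with hat | hat
    · rw [lintegral_Ioi_busyDensity hLc hM.intensity_le hb hb0 n (le_max_right _ _) hat,
        integral_busyDensity hL hb (fun n t ht => hM.hasDerivWithinAt_busy hk hkB hL hlam n ht)
          (fun n => by classical simp [hM.stateProb_zero hk hkB]) n hat]
      -- The elapsed time is at least `a` exactly if the service started by time `t - max a 0`.
      obtain ⟨s, hs⟩ : ∃ s : ℝ≥0, (s : ℝ) = t - max a 0 := ⟨⟨_, sub_nonneg.2 hat⟩, rfl⟩
      have hst : s ≤ t := by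
        rw [← NNReal.coe_le_coe, hs]
        exact sub_le_self _ (le_max_right _ _)
      have key := hM.real_busy_inter_serviceStart_le hk hkB hst n
      simp only [hs, sub_sub_cancel] at key
      rw [← key, ofReal_measureReal]
      congr 1
      ext ω
      have hiff : ∀ ω ∈ D, a ≤ el ω ↔ serviceStart k B (fun v => N v ω) (fun i => S i ω) (J ω) ≤
          (s : ℝ≥0∞) := by
        intro ω hω
        have h1 : serviceStart k B (fun v => N v ω) (fun i => S i ω) (J ω) ≤ t := ((hDJ ω).1 hω).1
        obtain ⟨v, hv⟩ := exists_coe_eq_of_le_coe h1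
        have h2 := (hbounds ω hω).1
        simp only [el] at h2 ⊢
        rw [← hv] at h2 ⊢
        rw [ENNReal.coe_toReal] at h2 ⊢
        rw [ENNReal.coe_le_coe, ← NNReal.coe_le_coe, hs]
        constructor
        · intro h3
          have : max a 0 ≤ t - v := max_le h3 h2
          linarith
        · intro h3
          have := le_max_left a 0
          linarith
      constructor
      · rintro ⟨h1, h2⟩
        exact ⟨J ω, (hDJ ω).1 h2, (hiff ω h2).1 h1⟩
      · rintro ⟨j, hj, hsj⟩
        have hJj := huniq ω j hj
        have h2 : ω ∈ D := (hDJ ω).2 (hJj ▸ hj)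
        exact ⟨(hiff ω h2).2 (hJj.symm ▸ hsj), h2⟩
    -- The elapsed time lies in `[0, t]` and the density vanishes beyond `t`, so both sides are `0`.
    · have h1 : el ⁻¹' Ici a ∩ D = ∅ := by
        refine eq_empty_of_forall_notMem fun ω hω => ?_
        have h2 := hbounds ω hω.2
        have h3 : a ≤ el ω := hω.1
        have : max a 0 ≤ t := max_le (h3.trans h2.2) (h2.1.trans h2.2)
        linarith
      rw [h1, measure_empty, setLIntegral_congr_fun (g := fun _ => 0) measurableSet_Ioi,
        lintegral_zero]
      intro x hx
      simp only
      rw [busyDensity, if_neg (not_le.2 (hat.trans hx)), ENNReal.ofReal_zero]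
  rw [hevent, ← Measure.restrict_apply (hel hE), ← Measure.map_apply hel hE, hmeasure,
    withDensity_apply _ hE, Measure.restrict_restrict hE]

/-- The tail formula at `x = 0`, where the Poisson distribution with parameter `0` is concentrated
at `0` and the convolution collapses. -/
lemma integral_busyDensity_eq_stateProb (hL : ∀ t, HasDerivAt L (lam t) t)
    (hlam : Continuous lam) (hlam0 : ∀ t, 0 ≤ lam t) (n : ℕ) {t : ℝ} (ht : 0 ≤ t) :
    ∫ x in Ioi 0, busyDensity L μ (startRate P k B N S lam μ) n x t =
      stateProb P k B N S {(true, n)} t := by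
  have hLc : Continuous L := continuous_iff_continuousAt.2 fun t => (hL t).continuousAt
  have hb := hM.continuous_startRate hk hkB hLc hlam
  have hb0 : ∀ n t, 0 ≤ t → 0 ≤ startRate P k B N S lam μ n t :=
    fun n t _ => hM.startRate_nonneg hlam0 n t
  have htail := integral_busyDensity hL hb
    (fun n t ht => hM.hasDerivWithinAt_busy hk hkB hL hlam n ht)
    (fun n => by classical simp [hM.stateProb_zero hk hkB]) n ht
  rw [integral_eq_lintegral_of_nonneg_ae, lintegral_Ioi_busyDensity hLc hM.intensity_le hb hb0 n
    le_rfl ht, htail, ENNReal.toReal_ofReal]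
  · rw [conv, Finset.sum_range_succ, Finset.sum_eq_zero]
    · simp [poissonWeight_zero_left]
    · intro m hm
      have : n - m ≠ 0 := by have := Finset.mem_range.1 hm; omega
      simp [poissonWeight_zero_left, this]
  · rw [sub_zero, sub_self]
    exact mul_nonneg (Real.exp_pos _).le (conv_nonneg (fun m => measureReal_nonneg)
      (poissonWeight_nonneg le_rfl) n)
  · filter_upwards [ae_restrict_mem measurableSet_Ioi] with x hx
    exact busyDensity_nonneg hM.intensity_le hb0 n (le_of_lt hx)
  · exact (measurable_busyDensity hLc hb n t).aestronglyMeasurable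

end IsQueueModel

/-! ### Almost sure modification of the service times -/

section Congr

variable {Ω : Type*} [MeasurableSpace Ω] {P : Measure Ω} {k B : ℕ} {N : ℝ≥0 → Ω → ℕ}
  {S S' : ℕ → Ω → ℝ}

lemma idleProb_congr_ae (h : ∀ᵐ ω ∂P, ∀ j, S j ω = S' j ω) (r : ℕ) :
    idleProb P k B N S r = idleProb P k B N S' r := by
  funext t
  refine measureReal_congr ?_
  filter_upwards [h] with ω hω
  exact congrArg (fun s => IdleAt k B (fun u => N u ω) s t.toNNReal r) (funext hω)

lemma IsBusyDensity.congr_ae {p : ℕ → ℝ → ℝ → ℝ} (hp : IsBusyDensity P k B N S p)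
    (h : ∀ᵐ ω ∂P, ∀ j, S j ω = S' j ω) : IsBusyDensity P k B N S' p := by
  refine ⟨hp.measurable, hp.nonneg, fun n t ht E hE => ?_⟩
  rw [← hp.density n t ht E hE]
  refine measure_congr ?_
  filter_upwards [h] with ω hω
  exact (congrArg (fun s => ∃ x ∈ E, BusyAt k B (fun u => N u ω) s t.toNNReal n x)
    (funext hω)).symm

end Congr

/-! ### The cumulated intensity -/

section Intensity

variable {lam : ℝ → ℝ}

/-- The intensity is controlled only on `[0, ∞)`. Extending it by its value at `0` makes it
continuous on the line, so its primitive is differentiable everywhere. -/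
lemma continuous_comp_max_zero (hlam : ContinuousOn lam (Ici 0)) :
    Continuous fun t => lam (max t 0) :=
  hlam.comp_continuous (by fun_prop) fun _ => mem_Ici.2 (le_max_right _ _)

lemma hasDerivAt_integral_comp_max_zero (hlam : ContinuousOn lam (Ici 0)) (t : ℝ) :
    HasDerivAt (fun t => ∫ v in (0 : ℝ)..t, lam (max v 0)) (lam (max t 0)) t :=
  intervalIntegral.integral_hasDerivAt_right
    ((continuous_comp_max_zero hlam).intervalIntegrable _ _)
    ((continuous_comp_max_zero hlam).stronglyMeasurableAtFilter _ _)
    (continuous_comp_max_zero hlam).continuousAt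

lemma integral_eq_sub_comp_max_zero (hlam : ContinuousOn lam (Ici 0)) {t u : ℝ} (ht : 0 ≤ t)
    (htu : t ≤ u) : ∫ v in t..u, lam v =
      (∫ v in (0 : ℝ)..u, lam (max v 0)) - ∫ v in (0 : ℝ)..t, lam (max v 0) := by
  have hc := continuous_comp_max_zero hlam
  rw [intervalIntegral.integral_interval_sub_left (hc.intervalIntegrable _ _)
    (hc.intervalIntegrable _ _)]
  refine intervalIntegral.integral_congr fun v hv => ?_
  rw [uIcc_of_le htu] at hv
  simp only [max_eq_left (ht.trans hv.1)]

end Intensity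

lemma IsPoissonProcess.isQueueModel {Ω : Type*} [MeasurableSpace Ω] {P : Measure Ω}
    {lam : ℝ → ℝ} (hlam : ContinuousOn lam (Ici 0)) (hlam0 : ∀ t, 0 ≤ t → 0 ≤ lam t)
    {μ : ℝ} (hμ : 0 < μ) {N : ℝ≥0 → Ω → ℕ} (hN : IsPoissonProcess lam N P)
    {S : ℕ → Ω → ℝ} (hSm : ∀ j, Measurable (S j)) (hS : ∀ j, HasLaw (S j) (expMeasure μ) P)
    (hSi : iIndepFun S P) (hNS : IndepFun (fun ω t => N t ω) (fun ω j => S j ω) P) :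
    IsQueueModel P (fun t => ∫ v in (0 : ℝ)..t, lam (max v 0)) μ N S where
  measurable_arrivals := hN.measurable
  zero := hN.zero
  path ω := ⟨hN.mono ω, hN.right_continuous ω⟩
  indep_increments := hN.indep_increments
  monotone_intensity t u htu := by
    rw [← sub_nonneg, ← integral_eq_sub_comp_max_zero hlam t.coe_nonneg (NNReal.coe_le_coe.2 htu)]
    exact intervalIntegral.integral_nonneg (NNReal.coe_le_coe.2 htu) fun v hv =>
        hlam0 v (t.coe_nonneg.trans hv.1)
  law_increment t u htu m := by
    have h0 : 0 ≤ ∫ v in (t : ℝ)..u, lam v :=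
      intervalIntegral.integral_nonneg (NNReal.coe_le_coe.2 htu) fun v hv =>
        hlam0 v (t.coe_nonneg.trans hv.1)
    have h1 := (hN.law_increment t u htu).measure_eq (p := fun i => i = m)
      (MeasurableSet.of_discrete)
    rw [h1, ofPred_eq_eq_singleton, poissonMeasure_singleton, Real.coe_toNNReal _ h0,
      integral_eq_sub_comp_max_zero hlam t.coe_nonneg (NNReal.coe_le_coe.2 htu)]
    rfl
  rate_pos := hμ
  measurable_service := hSm
  law_service := hS
  iIndepFun_service := hSi
  indep_arrivals_service := hNS

end BulkQueue

/-! ### The equations of the queue -/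

theorem mainTheorem3 {Ω : Type*} [MeasurableSpace Ω] (P : Measure Ω) [IsProbabilityMeasure P]
    (k B : ℕ) (hk : 1 ≤ k) (hkB : k ≤ B)
    (lam : ℝ → ℝ) (hlam : ContinuousOn lam (Ici 0)) (hlam0 : ∀ t, 0 ≤ t → 0 ≤ lam t)
    (μ : ℝ) (hμ : 0 < μ)
    -- arrivals: a Poisson process of intensity `lam`
    (N : ℝ≥0 → Ω → ℕ) (hN : BulkQueue.IsPoissonProcess lam N P)
    -- service times: i.i.d. exponential with parameter `μ`, independent of the arrivals
    (S : ℕ → Ω → ℝ) (hS : ∀ j, HasLaw (S j) (expMeasure μ) P) (hSi : iIndepFun S P)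
    (hNS : IndepFun (fun ω t => N t ω) (fun ω j => S j ω) P) :
    ∃ p : ℕ → ℝ → ℝ → ℝ, BulkQueue.IsBusyDensity P k B N S p ∧
      -- equations for the idle states
      (∀ t, 0 ≤ t → HasDerivWithinAt (BulkQueue.idleProb P k B N S 0)
        (-lam t * BulkQueue.idleProb P k B N S 0 t + μ * ∫ x in Ioi 0, p 0 x t) (Ici 0) t) ∧
      (∀ r, 1 ≤ r → r < k → ∀ t, 0 ≤ t → HasDerivWithinAt (BulkQueue.idleProb P k B N S r)
        (-lam t * BulkQueue.idleProb P k B N S r t + lam t * BulkQueue.idleProb P k B N S (r - 1) t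
          + μ * ∫ x in Ioi 0, p r x t) (Ici 0) t) ∧
      -- transport equations for the busy states
      (∀ n x t, 0 ≤ x → 0 ≤ t →
        BulkQueue.HasTransportDeriv (p n) (BulkQueue.transportRhs lam μ p n x t) x t) ∧
      (DifferentiableOn ℝ lam (Ioi 0) → ∀ n x t, 0 ≤ x → 0 ≤ t → x ≠ t →
        BulkQueue.HasPartialsSum (p n) (BulkQueue.transportRhs lam μ p n x t) x t) ∧
      -- boundary conditions
      (∀ t, 0 ≤ t → p 0 0 t = μ * (∑ i ∈ Finset.Icc k B, ∫ x in Ioi 0, p i x t)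
          + lam t * BulkQueue.idleProb P k B N S (k - 1) t) ∧
      (∀ n, 1 ≤ n → ∀ t, 0 ≤ t → p n 0 t = μ * ∫ x in Ioi 0, p (n + B) x t) ∧
      -- initial conditions
      BulkQueue.idleProb P k B N S 0 0 = 1 ∧
      (∀ r, 1 ≤ r → r < k → BulkQueue.idleProb P k B N S r 0 = 0) ∧
      (∀ n x, 0 < x → p n x 0 = 0) := by
  classical
  -- `HasLaw` provides only almost everywhere measurable service times. Measurable versions agree
  -- with them simultaneously for all `j` outside a null set, which affects neither the
  -- probabilities nor the independence.
  set S' : ℕ → Ω → ℝ := fun j => (hS j).aemeasurable.mk (S j)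
  have hSS' : ∀ j, S j =ᵐ[P] S' j := fun j => (hS j).aemeasurable.ae_eq_mk
  have hae : ∀ᵐ ω ∂P, ∀ j, S' j ω = S j ω := by
    rw [ae_all_iff]
    exact fun j => (hSS' j).symm
  have hNS' : IndepFun (fun ω t => N t ω) (fun ω j => S' j ω) P :=
    hNS.congr Filter.EventuallyEq.rfl (by
      filter_upwards [hae] with ω hω
      exact (funext hω).symm)
  have hM := hN.isQueueModel hlam hlam0 hμ (fun j => (hS j).aemeasurable.measurable_mk)
    (fun j => (hS j).congr (hSS' j).symm) (hSi.congr hSS') hNS'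
  set lam' : ℝ → ℝ := fun t => lam (max t 0) with hlam'
  have hlamc : Continuous lam' := BulkQueue.continuous_comp_max_zero hlam
  have hlamn : ∀ t, 0 ≤ lam' t := fun t => hlam0 _ (le_max_right _ _)
  have hL := BulkQueue.hasDerivAt_integral_comp_max_zero hlam
  have heq : ∀ t, 0 ≤ t → lam t = lam' t := fun t ht => by simp only [hlam', max_eq_left ht]
  have hidle : ∀ r, BulkQueue.idleProb P k B N S r =
      BulkQueue.stateProb P k B N S' {(false, r)} := fun r => by
    rw [← hM.idleProb_eq hk hkB, BulkQueue.idleProb_congr_ae hae]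
  have hint := fun n t ht =>
    hM.integral_busyDensity_eq_stateProb hk hkB hL hlamc hlamn n (t := t) ht
  have hrhs : ∀ p n x t, 0 ≤ t → BulkQueue.transportRhs lam μ p n x t =
      BulkQueue.transportRhs lam' μ p n x t := by
    intro p n x t ht
    rw [BulkQueue.transportRhs_eq, BulkQueue.transportRhs_eq, heq t ht]
  refine ⟨_, (hM.isBusyDensity hk hkB hL hlamc hlamn).congr_ae hae, fun t ht => ?_,
    fun r hr hrk t ht => ?_, fun n x t hx ht => ?_, fun hd n x t hx ht hxt => ?_, fun t ht => ?_,
    fun n hn t ht => ?_, ?_, fun r hr hrk => ?_, fun n x hx => ?_⟩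
  · rw [hidle, hint 0 t ht, heq t ht]
    exact hM.hasDerivWithinAt_idle_zero hk hkB hL hlamc ht
  · obtain ⟨r, rfl⟩ := Nat.exists_eq_add_of_le' hr
    rw [hidle, hidle, hint _ t ht, heq t ht]
    exact hM.hasDerivWithinAt_idle_succ hk hkB hL hlamc hrk ht
  · rw [hrhs _ _ _ _ ht]
    exact BulkQueue.hasTransportDeriv_busyDensity hL n
  · rw [hrhs _ _ _ _ ht]
    -- The start rates are evaluated at `t - x > 0`, so differentiability of the intensity on the
    -- open half-line suffices.
    refine BulkQueue.hasPartialsSum_busyDensity hL (fun m s hs => ?_) n hxt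
    refine hM.differentiableAt_startRate hk hkB hL hlamc (fun v hv => ?_) m hs
    refine ((hd v hv).differentiableAt (Ioi_mem_nhds hv)).congr_of_eventuallyEq ?_
    filter_upwards [Ioi_mem_nhds hv] with w hw
    exact (heq w (le_of_lt hw)).symm
  · rw [BulkQueue.busyDensity_zero_left 0 ht, hidle, heq t ht,
      Finset.sum_congr rfl fun i _ => hint i t ht]
    rfl
  · obtain ⟨n, rfl⟩ := Nat.exists_eq_add_of_le' hn
    rw [BulkQueue.busyDensity_zero_left _ ht, hint _ t ht]
    rfl
  · rw [hidle, hM.stateProb_zero hk hkB]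
    simp
  · rw [hidle, hM.stateProb_zero hk hkB]
    simp only [mem_singleton_iff, Prod.mk.injEq, true_and]
    rw [if_neg (by omega)]
  · rw [BulkQueue.busyDensity, if_neg (not_le.2 hx)]
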